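/- Let $\Bbbk$ be a field with $\operatorname{char}\Bbbk\neq 2$, and let $G$ be a super algebraic group over $\Bbbk$, given by its coordinate algebra $A=\mathcal O(G)$: a finitely generated super-commutative super Hopf algebra $A=A_0\oplus A_1$ over $\Bbbk$. (A super Hopf algebra is a $\mathbb Z/2$-graded algebra with a coassociative counital coproduct $\Delta:A\to A\otimes A$ and counit $\varepsilon:A\to\Bbbk$ that are $\mathbb Z/2$-graded algebra maps, where $A\otimes A$ has the product $(a\otimes b)(c\otimes d)=(-1)^{|b||c|}ac\otimes bd$, and with a graded antipode. Super-commutative means $ab=(-1)^{|a||b|}ba$ for homogeneous $a,b$.) Let $G_{ev}$ be the associated algebraic group, whose coordinate algebra is the commutative Hopf algebra $\mathcal O(G_{ev})=\overline A:=A/(A_1)$, the quotient of $A$ by the ideal generated by $A_1$, with the structure maps induced from those of $A$. A left integral for $G$ is a $\Bbbk$-linear (not necessarily grading-preserving) map $\int:A\to\Bbbk$ that is a map of left $A$-comodules, i.e. $\sum a_{(1)}\int a_{(2)}=\bigl(\int a\bigr)1$ for all $a\in A$, where $\Delta(a)=\sum a_{(1)}\otimes a_{(2)}$; left integrals for $G_{ev}$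 are defined in the same way with $\overline A$ in place of $A$. We say that a group has an integral if it has a nonzero left integral. Then the following are equivalent: (a) $G$ has an integral; (b) the associated algebraic group $G_{ev}$ has an integral. -/

import Mathlib

open scoped TensorProduct

set_option linter.unusedSectionVars false

noncomputable section

namespace SuperGroup

universe u v

section Basic

variable (k : Type u) {A : Type v} [Field k] [Ring A] [Algebra k A]

/-- The component of degree `i` of the super vector space `A ⊗ A`, for the total degree: the span
of the subspaces `A_p ⊗ A_q` with `p + q = i`. -/
def tensorDegree (𝒜 : ZMod 2 → Submodule k A) (i : ZMod 2) : Submodule k (A ⊗[k] A) :=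
  ⨆ (p : ZMod 2) (q : ZMod 2) (_ : p + q = i),
    LinearMap.range (TensorProduct.map (𝒜 p).subtype (𝒜 q).subtype)

/-- A super Hopf algebra over `k`: a `ZMod 2`-graded algebra `A` with a coalgebra structure whose
comultiplication and counit are `ZMod 2`-graded algebra maps, and with an antipode. Here
`A ⊗ A` carries the super product `(a ⊗ b) (c ⊗ d) = (-1) ^ (|b| |c|) (a c ⊗ b d)`; this is the
product of the graded tensor product `𝒜 ᵍ⊗[k] 𝒜`, whose underlying space is `A ⊗ A`. -/
class SuperHopfAlgebra (𝒜 : ZMod 2 → Submodule k A) [GradedAlgebra 𝒜] [Coalgebra k A] where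
  /-- The comultiplication preserves the degree. -/
  comul_mem : ∀ (i : ZMod 2), ∀ a ∈ 𝒜 i, Coalgebra.comul (R := k) a ∈ tensorDegree k 𝒜 i
  /-- The comultiplication is unital. -/
  comul_one : GradedTensorProduct.of k 𝒜 𝒜 (Coalgebra.comul (R := k) (1 : A)) = 1
  /-- The comultiplication is multiplicative for the super product on `A ⊗ A`. -/
  comul_mul : ∀ a b : A, GradedTensorProduct.of k 𝒜 𝒜 (Coalgebra.comul (R := k) (a * b)) =
    GradedTensorProduct.of k 𝒜 𝒜 (Coalgebra.comul (R := k) a) *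
      GradedTensorProduct.of k 𝒜 𝒜 (Coalgebra.comul (R := k) b)
  /-- The counit preserves the degree (`k` is purely even). -/
  counit_odd : ∀ a ∈ 𝒜 1, Coalgebra.counit (R := k) a = 0
  /-- The counit is unital. -/
  counit_one : Coalgebra.counit (R := k) (1 : A) = 1
  /-- The counit is multiplicative. -/
  counit_mul : ∀ a b : A, Coalgebra.counit (R := k) (a * b) =
    Coalgebra.counit (R := k) a * Coalgebra.counit (R := k) b
  /-- The antipode. -/
  antipode (𝒜) : A →ₗ[k] A
  /-- The antipode preserves the degree. -/
  antipode_mem : ∀ (i : ZMod 2), ∀ a ∈ 𝒜 i, antipode a ∈ 𝒜 i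
  /-- `∑ S(a₁) a₂ = ε(a) 1`. -/
  mul_antipode_rTensor_comul :
    LinearMap.mul' k A ∘ₗ antipode.rTensor A ∘ₗ Coalgebra.comul =
      Algebra.linearMap k A ∘ₗ Coalgebra.counit
  /-- `∑ a₁ S(a₂) = ε(a) 1`. -/
  mul_antipode_lTensor_comul :
    LinearMap.mul' k A ∘ₗ antipode.lTensor A ∘ₗ Coalgebra.comul =
      Algebra.linearMap k A ∘ₗ Coalgebra.counit

variable {k} in
/-- Super-commutativity: `a b = (-1) ^ (|a| |b|) b a` for homogeneous `a`, `b`. -/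
class SuperCommutative (𝒜 : ZMod 2 → Submodule k A) : Prop where
  even_comm : ∀ a ∈ 𝒜 0, ∀ b : A, a * b = b * a
  odd_anticomm : ∀ a ∈ 𝒜 1, ∀ b ∈ 𝒜 1, a * b = -(b * a)

/-- The space of left integrals on a coalgebra `A` with unit (the coordinate algebra of a group):
the linear maps `I : A → k` which are maps of left `A`-comodules, that is,
`∑ a₁ ⊗ I(a₂) = 1 ⊗ I(a)` in `A ⊗ k`. Here `A` coacts on itself by the comultiplication, and
on `k` trivially, by `c ↦ 1 ⊗ c`. -/
def leftIntegrals (A : Type v) [Ring A] [Algebra k A] [Coalgebra k A] :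
    Submodule k (A →ₗ[k] k) where
  carrier := {I | I.lTensor A ∘ₗ Coalgebra.comul = TensorProduct.mk k A k 1 ∘ₗ I}
  zero_mem' := by simp
  add_mem' {I J} hI hJ := by
    simp only [Set.mem_ofPred_eq] at *
    rw [LinearMap.lTensor_add, LinearMap.add_comp, hI, hJ, LinearMap.comp_add]
  smul_mem' c I hI := by
    simp only [Set.mem_ofPred_eq] at *
    rw [LinearMap.lTensor_smul, LinearMap.smul_comp, hI, LinearMap.comp_smul]

/-- The group with coordinate algebra `A` has an integral: there is a nonzero left integral. -/
def HasIntegral (A : Type v) [Ring A] [Algebra k A] [Coalgebra k A] : Prop :=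
  leftIntegrals k A ≠ ⊥

end Basic

section EvenPart

variable {k : Type u} {A : Type v} [Field k] [Ring A] [Algebra k A]
variable (𝒜 : ZMod 2 → Submodule k A) [GradedAlgebra 𝒜]

/-- The ideal `(A_1)` generated by the odd elements. -/
def oddIdeal (𝒜 : ZMod 2 → Submodule k A) : Ideal A := Ideal.span (𝒜 1 : Set A)

variable {𝒜} in
theorem odd_mem_oddIdeal {a : A} (ha : a ∈ 𝒜 1) : a ∈ oddIdeal 𝒜 := Ideal.subset_span ha

theorem exists_even_add_odd (a : A) : ∃ b ∈ 𝒜 0, ∃ c ∈ 𝒜 1, a = b + c := by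
  classical
  refine ⟨DirectSum.decompose 𝒜 a 0, SetLike.coe_mem _, DirectSum.decompose 𝒜 a 1,
    SetLike.coe_mem _, ?_⟩
  have h := DirectSum.sum_support_decompose 𝒜 a
  rw [Finset.sum_subset (Finset.subset_univ _) (by
    intro i _ hi
    simpa using hi)] at h
  exact h.symm.trans <| Fin.sum_univ_two (fun i : ZMod 2 => ((DirectSum.decompose 𝒜 a i : 𝒜 i) : A))

/-- The left ideal generated by the odd elements is two-sided. -/
instance : (oddIdeal 𝒜).IsTwoSided := by
  constructor
  intro a b ha
  induction ha using Submodule.span_induction with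
  | mem x hx =>
    obtain ⟨c, hc, d, hd, rfl⟩ := exists_even_add_odd 𝒜 b
    rw [mul_add]
    refine Ideal.add_mem _ (odd_mem_oddIdeal ?_) (Ideal.mul_mem_left _ _ (odd_mem_oddIdeal hd))
    simpa using SetLike.mul_mem_graded hx hc
  | zero => simp
  | add x y _ _ hx hy => rw [add_mul]; exact Ideal.add_mem _ hx hy
  | smul r x _ hx => rw [smul_eq_mul, mul_assoc]; exact Ideal.mul_mem_left _ _ hx

/-- The coordinate algebra `A / (A_1)` of the affine group associated with the super affine group
whose coordinate algebra is `A`. -/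
abbrev EvenQuotient := A ⧸ oddIdeal 𝒜

/-- The quotient map `A → A / (A_1)`. -/
abbrev evenMk : A →ₐ[k] EvenQuotient 𝒜 := Ideal.Quotient.mkₐ k (oddIdeal 𝒜)

variable {𝒜} in
theorem evenMk_odd {a : A} (ha : a ∈ 𝒜 1) : evenMk 𝒜 a = 0 :=
  Ideal.Quotient.eq_zero_iff_mem.mpr (odd_mem_oddIdeal ha)

/-- If `A` is super-commutative, then `A / (A_1)` is commutative. -/
theorem evenQuotient_mul_comm [SuperCommutative 𝒜] (x y : EvenQuotient 𝒜) : x * y = y * x := by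
  obtain ⟨a, rfl⟩ := Ideal.Quotient.mk_surjective x
  obtain ⟨b, rfl⟩ := Ideal.Quotient.mk_surjective y
  obtain ⟨c, hc, d, hd, rfl⟩ := exists_even_add_odd 𝒜 a
  have h : Ideal.Quotient.mk (oddIdeal 𝒜) d = 0 := evenMk_odd hd
  rw [map_add, h, add_zero, ← map_mul, ← map_mul, SuperCommutative.even_comm c hc b]

/-- The algebra map `A ⊗ A → A / (A_1) ⊗ A / (A_1)` from the super tensor product. -/
def gradedTensorToEven :
    GradedTensorProduct k 𝒜 𝒜 →ₐ[k] EvenQuotient 𝒜 ⊗[k] EvenQuotient 𝒜 :=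
  GradedTensorProduct.lift 𝒜 𝒜
    (Algebra.TensorProduct.includeLeft.comp (evenMk 𝒜))
    (Algebra.TensorProduct.includeRight.comp (evenMk 𝒜)) (by
      intro i j a b
      have h : ∀ i : ZMod 2, i = 0 ∨ i = 1 := by decide
      rcases h i with rfl | rfl
      · simp
      · have ha := evenMk_odd a.2
        simp only [AlgHom.comp_apply, ha, map_zero, zero_mul, mul_zero, smul_zero])

theorem gradedTensorToEven_of (x : A ⊗[k] A) :
    gradedTensorToEven 𝒜 (GradedTensorProduct.of k 𝒜 𝒜 x) =
      TensorProduct.map (evenMk 𝒜).toLinearMap (evenMk 𝒜).toLinearMap x := by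
  induction x using TensorProduct.induction_on with
  | zero => simp
  | add x y hx hy => simp only [map_add, hx, hy]
  | tmul a b =>
    refine (GradedTensorProduct.lift_tmul 𝒜 𝒜 _ _ _ a b).trans ?_
    simp

section Hopf

variable [Coalgebra k A] [SuperHopfAlgebra k 𝒜]

open Coalgebra

/-- The algebra map `A → A / (A_1) ⊗ A / (A_1)` induced by the comultiplication. -/
def preComul : A →ₐ[k] EvenQuotient 𝒜 ⊗[k] EvenQuotient 𝒜 :=
  AlgHom.ofLinearMap
    (TensorProduct.map (evenMk 𝒜).toLinearMap (evenMk 𝒜).toLinearMap ∘ₗ comul)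
    (by
      rw [LinearMap.comp_apply, ← gradedTensorToEven_of, SuperHopfAlgebra.comul_one, map_one])
    (by
      intro a b
      simp only [LinearMap.comp_apply]
      rw [← gradedTensorToEven_of, SuperHopfAlgebra.comul_mul, map_mul, gradedTensorToEven_of,
        gradedTensorToEven_of])

theorem preComul_odd {a : A} (ha : a ∈ 𝒜 1) : preComul 𝒜 a = 0 := by
  have h : tensorDegree k 𝒜 1 ≤ LinearMap.ker
      (TensorProduct.map (evenMk 𝒜).toLinearMap (evenMk 𝒜).toLinearMap) := by
    refine iSup_le fun p => iSup_le fun q => iSup_le fun hpq => ?_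
    rintro _ ⟨x, rfl⟩
    induction x using TensorProduct.induction_on with
    | zero => simp
    | add x y hx hy => rw [map_add]; exact Submodule.add_mem _ hx hy
    | tmul x y =>
      have hc : ∀ p q : ZMod 2, p + q = 1 → p = 1 ∨ q = 1 := by decide
      rcases hc p q hpq with rfl | rfl
      · have := evenMk_odd x.2
        simp only [LinearMap.mem_ker, TensorProduct.map_tmul, Submodule.subtype_apply,
          AlgHom.toLinearMap_apply, this, TensorProduct.zero_tmul]
      · have := evenMk_odd y.2
        simp only [LinearMap.mem_ker, TensorProduct.map_tmul, Submodule.subtype_apply,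
          AlgHom.toLinearMap_apply, this, TensorProduct.tmul_zero]
  exact h (SuperHopfAlgebra.comul_mem 1 a ha)

variable {𝒜} in
theorem map_oddIdeal {B : Type*} [Semiring B] [Algebra k B] (f : A →ₐ[k] B)
    (hf : ∀ a ∈ 𝒜 1, f a = 0) : ∀ a ∈ oddIdeal 𝒜, f a = 0 := by
  intro a ha
  have : oddIdeal 𝒜 ≤ RingHom.ker f := Ideal.span_le.mpr fun x hx => hf x hx
  exact this ha

/-- The comultiplication of `A / (A_1)`. -/
def evenComul : EvenQuotient 𝒜 →ₐ[k] EvenQuotient 𝒜 ⊗[k] EvenQuotient 𝒜 :=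
  Ideal.Quotient.liftₐ _ (preComul 𝒜)
    (map_oddIdeal (preComul 𝒜) fun _ ha => preComul_odd 𝒜 ha)

/-- The counit of `A` as an algebra map. -/
def preCounit : A →ₐ[k] k :=
  AlgHom.ofLinearMap counit (SuperHopfAlgebra.counit_one 𝒜) (SuperHopfAlgebra.counit_mul 𝒜)

/-- The counit of `A / (A_1)`. -/
def evenCounit : EvenQuotient 𝒜 →ₐ[k] k :=
  Ideal.Quotient.liftₐ _ (preCounit 𝒜)
    (map_oddIdeal (preCounit 𝒜) (SuperHopfAlgebra.counit_odd (𝒜 := 𝒜)))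

theorem evenComul_comp : (evenComul 𝒜).toLinearMap ∘ₗ (evenMk 𝒜).toLinearMap =
    TensorProduct.map (evenMk 𝒜).toLinearMap (evenMk 𝒜).toLinearMap ∘ₗ comul := rfl

theorem evenCounit_comp :
    (evenCounit 𝒜).toLinearMap ∘ₗ (evenMk 𝒜).toLinearMap = counit := rfl

/-- The bialgebra structure on `A / (A_1)` for which the quotient map preserves the
comultiplication and the counit. -/
instance : Bialgebra k (EvenQuotient 𝒜) := by
  refine .ofAlgHom (evenComul 𝒜) (evenCounit 𝒜) ?_ ?_ ?_ <;>
    refine Ideal.Quotient.algHom_ext k (AlgHom.toLinearMap_injective ?_) <;>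
    simp only [coassoc_simps, AlgHom.comp_toLinearMap, Algebra.TensorProduct.toLinearMap_map,
      evenComul_comp, evenCounit_comp]
  · simp [coassoc_simps]
  · rw [CoassocSimps.map_counit_comp_comul_left]; rfl
  · rw [CoassocSimps.map_counit_comp_comul_right]; rfl

/-- The map `A → A / (A_1)` induced by the antipode. -/
def preAntipode : A →ₗ[k] EvenQuotient 𝒜 :=
  (evenMk 𝒜).toLinearMap ∘ₗ SuperHopfAlgebra.antipode 𝒜

theorem mul_evenMk (x : A ⊗[k] A) :
    LinearMap.mul' k (EvenQuotient 𝒜)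
      (TensorProduct.map (evenMk 𝒜).toLinearMap (evenMk 𝒜).toLinearMap x) =
    evenMk 𝒜 (LinearMap.mul' k A x) := by
  induction x using TensorProduct.induction_on with
  | zero => simp
  | add x y hx hy => simp only [map_add, hx, hy]
  | tmul a b => simp

theorem preAntipode_mul_left (a : A) :
    LinearMap.mul' k (EvenQuotient 𝒜)
      (TensorProduct.map (preAntipode 𝒜) (evenMk 𝒜).toLinearMap (comul a)) =
    algebraMap k _ (counit (R := k) a) := by
  have h := congr(evenMk 𝒜 ($(SuperHopfAlgebra.mul_antipode_rTensor_comul (𝒜 := 𝒜)) a))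
  simp only [LinearMap.comp_apply, ← mul_evenMk, LinearMap.rTensor,
    Algebra.linearMap_apply, AlgHom.commutes] at h
  rw [← h, TensorProduct.map_map]
  rfl

theorem preAntipode_mul_right (a : A) :
    LinearMap.mul' k (EvenQuotient 𝒜)
      (TensorProduct.map (evenMk 𝒜).toLinearMap (preAntipode 𝒜) (comul a)) =
    algebraMap k _ (counit (R := k) a) := by
  have h := congr(evenMk 𝒜 ($(SuperHopfAlgebra.mul_antipode_lTensor_comul (𝒜 := 𝒜)) a))
  simp only [LinearMap.comp_apply, ← mul_evenMk, LinearMap.lTensor,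
    Algebra.linearMap_apply, AlgHom.commutes] at h
  rw [← h, TensorProduct.map_map]
  rfl

theorem mul_map_ttc (T : A →ₗ[k] EvenQuotient 𝒜) (x y : A ⊗[k] A) :
    LinearMap.mul' k (EvenQuotient 𝒜)
      (TensorProduct.map ((evenMk 𝒜).toLinearMap ∘ₗ LinearMap.mul' k A)
        (T ∘ₗ LinearMap.mul' k A) (TensorProduct.tensorTensorTensorComm k A A A A (x ⊗ₜ y))) =
    LinearMap.mul' k (EvenQuotient 𝒜)
      (TensorProduct.map (evenMk 𝒜).toLinearMap T
        ((GradedTensorProduct.of k 𝒜 𝒜).symm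
          (GradedTensorProduct.of k 𝒜 𝒜 x * GradedTensorProduct.of k 𝒜 𝒜 y))) := by
  have hc : ∀ i : ZMod 2, i = 0 ∨ i = 1 := by decide
  have key : ∀ (i j : ZMod 2) (a₁ b₂ : A), ∀ a₂ ∈ 𝒜 i, ∀ b₁ ∈ 𝒜 j,
      LinearMap.mul' k (EvenQuotient 𝒜)
        (TensorProduct.map ((evenMk 𝒜).toLinearMap ∘ₗ LinearMap.mul' k A)
          (T ∘ₗ LinearMap.mul' k A)
          (TensorProduct.tensorTensorTensorComm k A A A A ((a₁ ⊗ₜ a₂) ⊗ₜ (b₁ ⊗ₜ b₂)))) =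
      LinearMap.mul' k (EvenQuotient 𝒜)
        (TensorProduct.map (evenMk 𝒜).toLinearMap T
          ((GradedTensorProduct.of k 𝒜 𝒜).symm
            (GradedTensorProduct.of k 𝒜 𝒜 (a₁ ⊗ₜ a₂) *
              GradedTensorProduct.of k 𝒜 𝒜 (b₁ ⊗ₜ b₂)))) := by
    intro i j a₁ b₂ a₂ ha b₁ hb
    have h := GradedTensorProduct.tmul_coe_mul_coe_tmul (R := k) 𝒜 𝒜 a₁ ⟨a₂, ha⟩ ⟨b₁, hb⟩ b₂
    simp only at h
    rw [h]
    rcases hc j with rfl | rfl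
    · simp
    · have h1 := evenMk_odd hb
      rcases Int.units_eq_one_or ((-1 : ℤˣ) ^ (i * 1)) with h2 | h2 <;> rw [h2] <;>
        simp [h1, -Ideal.Quotient.mkₐ_eq_mk]
  induction x using TensorProduct.induction_on with
  | zero => simp
  | add x y hx hy => simp only [TensorProduct.add_tmul, map_add, add_mul, hx, hy]
  | tmul a₁ a₂ =>
    induction y using TensorProduct.induction_on with
    | zero => simp
    | add x y hx hy => simp only [TensorProduct.tmul_add, map_add, mul_add, hx, hy]
    | tmul b₁ b₂ =>
      obtain ⟨c, hc, d, hd, rfl⟩ := exists_even_add_odd 𝒜 a₂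
      obtain ⟨c', hc', d', hd', rfl⟩ := exists_even_add_odd 𝒜 b₁
      simp only [TensorProduct.tmul_add, TensorProduct.add_tmul, map_add, mul_add, add_mul]
      rw [key _ _ a₁ b₂ c hc c' hc', key _ _ a₁ b₂ c hc d' hd', key _ _ a₁ b₂ d hd c' hc',
        key _ _ a₁ b₂ d hd d' hd']

theorem mul_map_comm {B : Type*} [Ring B] [Algebra k B] (P : A →ₐ[k] B) (T : A →ₗ[k] B)
    (b₁ b₂ : A) (x : A ⊗[k] A) :
    LinearMap.mul' k B (TensorProduct.map
        (LinearMap.mul' k B ∘ₗ TensorProduct.map T T ∘ₗ (TensorProduct.comm k A A).toLinearMap)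
        (P.toLinearMap ∘ₗ LinearMap.mul' k A)
        (TensorProduct.tensorTensorTensorComm k A A A A (x ⊗ₜ (b₁ ⊗ₜ b₂)))) =
      T b₁ * LinearMap.mul' k B (TensorProduct.map T P.toLinearMap x) * P b₂ := by
  induction x using TensorProduct.induction_on with
  | zero => simp
  | add x y hx hy => simp only [TensorProduct.add_tmul, map_add, mul_add, add_mul, hx, hy]
  | tmul a₁ a₂ => simp [mul_assoc]

/-- The map induced by the antipode is anti-multiplicative. -/
theorem preAntipode_mul (a b : A) :
    preAntipode 𝒜 (a * b) = preAntipode 𝒜 b * preAntipode 𝒜 a := by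
  let P := (evenMk 𝒜).toLinearMap
  let T := preAntipode 𝒜
  let F : WithConv (A ⊗[k] A →ₗ[k] EvenQuotient 𝒜) := .toConv (P ∘ₗ LinearMap.mul' k A)
  let G : WithConv (A ⊗[k] A →ₗ[k] EvenQuotient 𝒜) := .toConv (T ∘ₗ LinearMap.mul' k A)
  let N : WithConv (A ⊗[k] A →ₗ[k] EvenQuotient 𝒜) := .toConv
    (LinearMap.mul' k _ ∘ₗ TensorProduct.map T T ∘ₗ (TensorProduct.comm k A A).toLinearMap)
  have hFG : F * G = 1 := by
    apply WithConv.ofConv_injective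
    refine TensorProduct.ext' fun a b => ?_
    refine (mul_map_ttc 𝒜 T (comul a) (comul b)).trans ?_
    rw [← SuperHopfAlgebra.comul_mul, LinearEquiv.symm_apply_apply]
    refine (preAntipode_mul_right 𝒜 (a * b)).trans ?_
    rw [SuperHopfAlgebra.counit_mul 𝒜]
    simpa using Algebra.commutes _ _
  have hNF : N * F = 1 := by
    apply WithConv.ofConv_injective
    refine TensorProduct.ext' fun a b => ?_
    have h : ∀ y : A ⊗[k] A, LinearMap.mul' k _ (TensorProduct.map N.ofConv F.ofConv
        (TensorProduct.tensorTensorTensorComm k A A A A (comul a ⊗ₜ y))) =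
        counit (R := k) a • LinearMap.mul' k _ (TensorProduct.map T P y) := by
      intro y
      induction y using TensorProduct.induction_on with
      | zero => simp
      | add x y hx hy => simp only [TensorProduct.tmul_add, map_add, smul_add, hx, hy]
      | tmul b₁ b₂ =>
        refine (mul_map_comm (evenMk 𝒜) T b₁ b₂ (comul a)).trans ?_
        rw [preAntipode_mul_left, ← Algebra.commutes, mul_assoc, ← Algebra.smul_def]
        rfl
    refine (h (comul b)).trans ?_
    rw [preAntipode_mul_left]
    simpa [Algebra.smul_def] using Algebra.commutes _ _
  have h := left_inv_eq_right_inv hNF hFG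
  have h2 := congr(($h).ofConv (a ⊗ₜ b))
  simpa [N, G, T] using h2.symm

theorem preAntipode_oddIdeal : ∀ a ∈ oddIdeal 𝒜, preAntipode 𝒜 a = 0 := by
  intro x hx
  induction hx using Submodule.span_induction with
  | mem x hx => exact evenMk_odd (SuperHopfAlgebra.antipode_mem 1 x hx)
  | zero => simp
  | add x y _ _ hx hy => rw [map_add, hx, hy, add_zero]
  | smul r x _ hx => rw [smul_eq_mul, preAntipode_mul, hx, zero_mul]

/-- The antipode of `A / (A_1)`. -/
def evenAntipode : EvenQuotient 𝒜 →ₗ[k] EvenQuotient 𝒜 :=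
  Submodule.liftQ ((oddIdeal 𝒜).restrictScalars k) (preAntipode 𝒜) (preAntipode_oddIdeal 𝒜)

theorem evenAntipode_comp :
    evenAntipode 𝒜 ∘ₗ (evenMk 𝒜).toLinearMap = preAntipode 𝒜 := rfl

theorem comul_evenMk (a : A) : comul (R := k) (evenMk 𝒜 a) =
    TensorProduct.map (evenMk 𝒜).toLinearMap (evenMk 𝒜).toLinearMap (comul a) := rfl

theorem counit_evenMk (a : A) : counit (R := k) (evenMk 𝒜 a) = counit (R := k) a := rfl

/-- The Hopf algebra structure on `A / (A_1)` for which the quotient map preserves all structure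
maps. -/
instance : HopfAlgebra k (EvenQuotient 𝒜) where
  antipode := evenAntipode 𝒜
  mul_antipode_rTensor_comul := by
    refine LinearMap.ext fun x => ?_
    obtain ⟨a, rfl⟩ := Ideal.Quotient.mkₐ_surjective k (oddIdeal 𝒜) x
    simp only [LinearMap.comp_apply, comul_evenMk, counit_evenMk, LinearMap.rTensor,
      TensorProduct.map_map, evenAntipode_comp, LinearMap.id_comp, preAntipode_mul_left,
      Algebra.linearMap_apply]
  mul_antipode_lTensor_comul := by
    refine LinearMap.ext fun x => ?_
    obtain ⟨a, rfl⟩ := Ideal.Quotient.mkₐ_surjective k (oddIdeal 𝒜) x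
    simp only [LinearMap.comp_apply, comul_evenMk, counit_evenMk, LinearMap.lTensor,
      TensorProduct.map_map, evenAntipode_comp, LinearMap.id_comp, preAntipode_mul_right,
      Algebra.linearMap_apply]

end Hopf

end EvenPart

end SuperGroup

end

/-!
Write `π : A → Ā = A / (A_1)` for the quotient map, and `F_j` for the `j`-th power of the ideal
`(A_1)`. As `A` is finitely generated, `(A_1)` is generated by finitely many odd elements, which
anticommute and have square zero in characteristic different from `2`; so `F_j = 0` for large `j`
(`exists_oddFiltration_eq_bot`). Since `Ā` is purely even, its two coactions on `A` are
multiplicative for the ordinary products, and each layer `F_j / F_{j+1}` is a Hopf module over `Ā`.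

The bridge between the two groups is a criterion (`hasIntegral_of_finite_range`): a nonzero
functional `f` that vanishes on the odd part gives a nonzero integral as soon as the elements
`∑ f(a₂) a₁` span a finite-dimensional space. That space is the target of a comodule map from `A`,
and a Hopf module argument, here a supertrace of matrix coefficients (`hasIntegral_of_matrix`),
turns nonzero comodule maps `A → V` with `V` finite-dimensional into integrals. The criterion also
applies to ordinary commutative Hopf algebras, as purely even super Hopf algebras.

If `φ` is an integral for `Ā`, take `f = φ ∘ π`. The elements `∑ f(a₂) a₁` are then coinvariants
for the right coaction of `Ā`. The coinvariants are finite-dimensional (`rightCoinvariants_fg`):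
a coinvariant in `F_j` is determined modulo `F_{j+1}` by its class in `F_j / M F_j`, where `M` is
the kernel of the counit, and this quotient is finite-dimensional.

If `φ` is an integral for `A`, let `F_j` be the last layer on which it does not vanish and take
`x ∈ F_j` with `φ(x) ≠ 0`. Then `y ↦ φ(y x)` is well defined on `Ā`, since `φ` kills `F_{j+1}`, and
left invariance of `φ` together with the antipode shows that its translates are
`∑ φ(y x₂) S(π(x₁))`, which lie in the finite-dimensional space determined by `x`
(`translate_section`).
-/

noncomputable section

namespace SuperGroup

open Coalgebra

universe u v

/-! ### The filtration by powers of the odd part -/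

section Filtration

variable {k : Type u} {A : Type v} [Field k] [Ring A] [Algebra k A]
variable (𝒜 : ZMod 2 → Submodule k A) [GradedAlgebra 𝒜]

theorem proj_mem (i : ZMod 2) (a : A) : GradedAlgebra.proj 𝒜 i a ∈ 𝒜 i := SetLike.coe_mem _

theorem proj_same {i : ZMod 2} {a : A} (ha : a ∈ 𝒜 i) : GradedAlgebra.proj 𝒜 i a = a :=
  DirectSum.decompose_of_mem_same _ ha

theorem proj_ne {i j : ZMod 2} {a : A} (ha : a ∈ 𝒜 i) (hij : i ≠ j) :
    GradedAlgebra.proj 𝒜 j a = 0 :=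
  DirectSum.decompose_of_mem_ne _ ha hij

theorem proj_add_proj (a : A) : GradedAlgebra.proj 𝒜 0 a + GradedAlgebra.proj 𝒜 1 a = a := by
  obtain ⟨b, hb, c, hc, rfl⟩ := exists_even_add_odd 𝒜 a
  rw [map_add, map_add, proj_same 𝒜 hb, proj_same 𝒜 hc, proj_ne 𝒜 hb (by decide),
    proj_ne 𝒜 hc (by decide), add_zero, zero_add]

/-- The `j`-th power of the ideal `(A_1)`, for every `j` including `j = 0`, as a `k`-subspace: it
is spanned by the products of an arbitrary element and `j` odd elements. -/
def oddFiltration (j : ℕ) : Submodule k A := ⊤ * 𝒜 1 ^ j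

theorem top_mul_top : (⊤ : Submodule k A) * ⊤ = ⊤ :=
  eq_top_iff.mpr fun a _ => by
    simpa using Submodule.mul_mem_mul (Submodule.mem_top (x := a)) (Submodule.mem_top (x := 1))

theorem oddFiltration_zero : oddFiltration 𝒜 0 = ⊤ := by
  rw [oddFiltration, pow_zero, mul_one]

theorem top_mul_oddFiltration (j : ℕ) : ⊤ * oddFiltration 𝒜 j = oddFiltration 𝒜 j := by
  rw [oddFiltration, ← mul_assoc, top_mul_top]

theorem mul_mem_oddFiltration {j : ℕ} (a : A) {x : A} (hx : x ∈ oddFiltration 𝒜 j) :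
    a * x ∈ oddFiltration 𝒜 j := by
  rw [← top_mul_oddFiltration]
  exact Submodule.mul_mem_mul Submodule.mem_top hx

theorem oddIdeal_eq : (oddIdeal 𝒜).restrictScalars k = oddFiltration 𝒜 1 := by
  apply le_antisymm
  · intro x hx
    replace hx : x ∈ Ideal.span (𝒜 1 : Set A) := hx
    induction hx using Submodule.span_induction with
    | mem x hx => simpa [oddFiltration] using
        Submodule.mul_mem_mul (Submodule.mem_top (R := k) (x := (1 : A))) hx
    | zero => exact zero_mem _
    | add x y _ _ hx hy => exact add_mem hx hy
    | smul r x _ hx => exact mul_mem_oddFiltration 𝒜 r hx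
  · rw [oddFiltration, pow_one, Submodule.mul_le]
    exact fun a _ x hx => Ideal.mul_mem_left _ a (odd_mem_oddIdeal hx)

theorem mul_mem_oddFiltration_succ {j : ℕ} {a x : A} (ha : a ∈ oddIdeal 𝒜)
    (hx : x ∈ oddFiltration 𝒜 j) : a * x ∈ oddFiltration 𝒜 (j + 1) := by
  -- `(A_1)` is a two-sided ideal, so `A_1 A ⊆ A A_1`
  have h : 𝒜 1 * ⊤ ≤ ⊤ * 𝒜 1 := by
    have h1 : ⊤ * 𝒜 1 = (oddIdeal 𝒜).restrictScalars k := by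
      rw [oddIdeal_eq, oddFiltration, pow_one]
    rw [h1, Submodule.mul_le]
    exact fun a ha b _ => Ideal.mul_mem_right _ _ (odd_mem_oddIdeal ha)
  have ha' : a ∈ oddFiltration 𝒜 1 := by rw [← oddIdeal_eq]; exact ha
  have h2 : oddFiltration 𝒜 1 * oddFiltration 𝒜 j ≤ oddFiltration 𝒜 (j + 1) := by
    rw [oddFiltration, oddFiltration, oddFiltration, pow_one, pow_succ']
    calc ⊤ * 𝒜 1 * (⊤ * 𝒜 1 ^ j) = ⊤ * (𝒜 1 * ⊤) * 𝒜 1 ^ j := by simp only [mul_assoc]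
      _ ≤ ⊤ * (⊤ * 𝒜 1) * 𝒜 1 ^ j := by gcongr
      _ = ⊤ * (𝒜 1 * 𝒜 1 ^ j) := by rw [← mul_assoc ⊤ ⊤, top_mul_top, mul_assoc]
  exact h2 (Submodule.mul_mem_mul ha' hx)

/-- The odd parts of finitely many algebra generators generate the ideal `(A_1)`: the odd part of a
product `x y` is `x₀ y₁ + y₀ x₁`. -/
theorem exists_odd_generators [SuperCommutative 𝒜] [Algebra.FiniteType k A] :
    ∃ X : Submodule k A, X.FG ∧ X ≤ 𝒜 1 ∧ 𝒜 1 ≤ ⊤ * X := by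
  obtain ⟨s, hs⟩ := Algebra.FiniteType.out (R := k) (A := A)
  refine ⟨Submodule.span k (GradedAlgebra.proj 𝒜 1 '' s),
    Submodule.fg_span (s.finite_toSet.image _), ?_, ?_⟩
  · rw [Submodule.span_le]
    rintro _ ⟨a, _, rfl⟩
    exact proj_mem 𝒜 1 a
  set X := Submodule.span k (GradedAlgebra.proj 𝒜 1 '' (s : Set A))
  have hX : ∀ a : A, ∀ x ∈ ⊤ * X, a * x ∈ ⊤ * X := by
    intro a x hx
    rw [← top_mul_top, mul_assoc]
    exact Submodule.mul_mem_mul Submodule.mem_top hx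
  have key : ∀ a : A, GradedAlgebra.proj 𝒜 1 a ∈ ⊤ * X := by
    intro a
    have ha : a ∈ Algebra.adjoin k (s : Set A) := hs ▸ Algebra.mem_top
    induction ha using Algebra.adjoin_induction with
    | mem x hx =>
      rw [← one_mul (GradedAlgebra.proj 𝒜 1 x)]
      exact Submodule.mul_mem_mul Submodule.mem_top (Submodule.subset_span ⟨x, hx, rfl⟩)
    | algebraMap r =>
      rw [proj_ne 𝒜 (SetLike.algebraMap_mem_graded 𝒜 r) (by decide)]
      exact zero_mem _
    | add x y _ _ hx hy => rw [map_add]; exact add_mem hx hy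
    | mul x y _ _ hx hy =>
      have h : GradedAlgebra.proj 𝒜 1 (x * y) =
          GradedAlgebra.proj 𝒜 0 x * GradedAlgebra.proj 𝒜 1 y +
            GradedAlgebra.proj 𝒜 0 y * GradedAlgebra.proj 𝒜 1 x := by
        have h00 := SetLike.mul_mem_graded (proj_mem 𝒜 0 x) (proj_mem 𝒜 0 y)
        have h01 := SetLike.mul_mem_graded (proj_mem 𝒜 0 x) (proj_mem 𝒜 1 y)
        have h10 := SetLike.mul_mem_graded (proj_mem 𝒜 1 x) (proj_mem 𝒜 0 y)
        have h11 := SetLike.mul_mem_graded (proj_mem 𝒜 1 x) (proj_mem 𝒜 1 y)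
        conv_lhs => rw [← proj_add_proj 𝒜 x, ← proj_add_proj 𝒜 y]
        rw [SuperCommutative.even_comm _ (proj_mem 𝒜 0 y), add_mul, mul_add, mul_add]
        simp only [map_add]
        rw [proj_ne 𝒜 h00 (by decide), proj_ne 𝒜 h11 (by decide),
          proj_same 𝒜 (i := 1) h01, proj_same 𝒜 (i := 1) h10]
        abel
      rw [h]
      exact add_mem (hX _ _ hy) (hX _ _ hx)
  exact fun a ha => proj_same 𝒜 ha ▸ key a

/-- A finite-dimensional space of odd elements is nilpotent, since its powers are quotients of its
exterior powers. -/
theorem exists_pow_eq_bot [SuperCommutative 𝒜] (hk : ringChar k ≠ 2) {X : Submodule k A}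
    (hfg : X.FG) (hX : X ≤ 𝒜 1) : ∃ N : ℕ, X ^ N = ⊥ := by
  have : Module.Finite k X := Module.Finite.iff_fg.mpr hfg
  have hsq : ∀ x : X, X.subtype x * X.subtype x = 0 := by
    intro x
    have h := SuperCommutative.odd_anticomm (x : A) (hX x.2) x (hX x.2)
    have h2 : (2 : k) • ((x : A) * x) = 0 := by
      rw [two_smul]
      nth_rewrite 1 [h]
      exact neg_add_cancel _
    exact (smul_eq_zero.mp h2).resolve_left (Ring.two_ne_zero hk)
  refine ⟨Module.finrank k X + 1, ?_⟩
  let Φ := ExteriorAlgebra.lift k ⟨X.subtype, hsq⟩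
  have h1 : Submodule.map Φ.toLinearMap (LinearMap.range (ExteriorAlgebra.ι k (M := X))) = X := by
    rw [← LinearMap.range_comp, ExteriorAlgebra.ι_comp_lift, Submodule.range_subtype]
  have h2 : (⋀[k]^(Module.finrank k X + 1) X) = ⊥ := by
    rw [← Submodule.finrank_eq_zero (R := k), exteriorPower.finrank_eq, Nat.choose_succ_self]
  calc X ^ (Module.finrank k X + 1)
      = (Submodule.map Φ.toLinearMap (LinearMap.range (ExteriorAlgebra.ι k (M := X)))) ^
          (Module.finrank k X + 1) := by rw [h1]
    _ = Submodule.map Φ.toLinearMap (⋀[k]^(Module.finrank k X + 1) X) := by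
      rw [← Submodule.map_pow]
    _ = ⊥ := by rw [h2, Submodule.map_bot]

theorem oddFiltration_le [SuperCommutative 𝒜] {X : Submodule k A} (hX : X ≤ 𝒜 1)
    (hgen : 𝒜 1 ≤ ⊤ * X) (j : ℕ) : oddFiltration 𝒜 j ≤ ⊤ * X ^ j := by
  have hcomm : X * ⊤ ≤ ⊤ * X := by
    rw [Submodule.mul_le]
    intro x hx a _
    obtain ⟨b, hb, c, hc, rfl⟩ := exists_even_add_odd 𝒜 a
    rw [mul_add, ← SuperCommutative.even_comm b hb, SuperCommutative.odd_anticomm x (hX hx) c hc]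
    exact add_mem (Submodule.mul_mem_mul Submodule.mem_top hx)
      (neg_mem (Submodule.mul_mem_mul Submodule.mem_top hx))
  have h : ∀ j : ℕ, X ^ j * ⊤ ≤ ⊤ * X ^ j := by
    intro j
    induction j with
    | zero => simp
    | succ j ih =>
      calc X ^ (j + 1) * ⊤ = X ^ j * (X * ⊤) := by rw [pow_succ, mul_assoc]
        _ ≤ X ^ j * (⊤ * X) := by gcongr
        _ = X ^ j * ⊤ * X := by rw [mul_assoc]
        _ ≤ ⊤ * X ^ j * X := by gcongr
        _ = ⊤ * X ^ (j + 1) := by rw [pow_succ, mul_assoc]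
  have h1 : ∀ j : ℕ, 𝒜 1 ^ j ≤ ⊤ * X ^ j := by
    intro j
    induction j with
    | zero =>
      rw [pow_zero, pow_zero, mul_one]
      exact le_top
    | succ j ih =>
      calc 𝒜 1 ^ (j + 1) = 𝒜 1 ^ j * 𝒜 1 := pow_succ _ _
        _ ≤ ⊤ * X ^ j * (⊤ * X) := by gcongr
        _ = ⊤ * (X ^ j * ⊤) * X := by simp only [mul_assoc]
        _ ≤ ⊤ * (⊤ * X ^ j) * X :=
          mul_le_mul' (mul_le_mul' le_rfl (h j)) le_rfl
        _ = ⊤ * X ^ (j + 1) := by rw [← mul_assoc ⊤ ⊤, top_mul_top, pow_succ, mul_assoc]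
  calc oddFiltration 𝒜 j ≤ ⊤ * (⊤ * X ^ j) := by rw [oddFiltration]; gcongr; exact h1 j
    _ = ⊤ * X ^ j := by rw [← mul_assoc, top_mul_top]

theorem exists_oddFiltration_eq_bot [SuperCommutative 𝒜] [Algebra.FiniteType k A]
    (hk : ringChar k ≠ 2) : ∃ N : ℕ, oddFiltration 𝒜 N = ⊥ := by
  obtain ⟨X, hfg, hX, hgen⟩ := exists_odd_generators 𝒜
  obtain ⟨N, hN⟩ := exists_pow_eq_bot 𝒜 hk hfg hX
  refine ⟨N, le_bot_iff.mp ?_⟩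
  simpa [hN] using oddFiltration_le 𝒜 hX hgen N

end Filtration

/-! ### Translates of functionals -/

section Translate

variable {k : Type u} {A : Type v} [Field k] [Ring A] [Algebra k A]

/-- The contraction `z ⊗ a ↦ g(a) z`. -/
def contract {M N : Type*} [AddCommGroup M] [Module k M] [AddCommGroup N] [Module k N]
    (g : N →ₗ[k] k) : M ⊗[k] N →ₗ[k] M :=
  (TensorProduct.rid k M).toLinearMap ∘ₗ g.lTensor M

@[simp] theorem contract_tmul {M N : Type*} [AddCommGroup M] [Module k M] [AddCommGroup N]
    [Module k N] (g : N →ₗ[k] k) (x : M) (y : N) : contract g (x ⊗ₜ[k] y) = g y • x := by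
  simp [contract]

theorem contract_comp {M N P : Type*} [AddCommGroup M] [Module k M] [AddCommGroup N] [Module k N]
    [AddCommGroup P] [Module k P] (g : P →ₗ[k] k) (F : N →ₗ[k] P) (x : M ⊗[k] N) :
    contract g (F.lTensor M x) = contract (g ∘ₗ F) x := by
  induction x using TensorProduct.induction_on with
  | zero => simp
  | add x y hx hy => simp only [map_add, hx, hy]
  | tmul a b => simp

variable [Coalgebra k A]

/-- The map `a ↦ ∑ g(a₂) a₁`, the map of left comodules `A → A` whose composite with the counit
is `g`. -/
def translate (g : A →ₗ[k] k) : A →ₗ[k] A := contract g ∘ₗ comul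

theorem mem_leftIntegrals_iff {I : A →ₗ[k] k} :
    I ∈ leftIntegrals k A ↔ ∀ a, translate I a = I a • (1 : A) := by
  change I.lTensor A ∘ₗ comul = TensorProduct.mk k A k 1 ∘ₗ I ↔ _
  rw [LinearMap.ext_iff]
  refine forall_congr' fun a => ?_
  rw [← (TensorProduct.rid k A).injective.eq_iff]
  simp [translate, contract]

theorem hasIntegral_iff : HasIntegral k A ↔
    ∃ I : A →ₗ[k] k, I ≠ 0 ∧ ∀ a, translate I a = I a • (1 : A) := by
  rw [HasIntegral, Submodule.ne_bot_iff]
  simp only [mem_leftIntegrals_iff]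
  exact exists_congr fun _ => and_comm

theorem counit_translate (g : A →ₗ[k] k) (a : A) : counit (R := k) (translate g a) = g a := by
  have h : ∀ x : A ⊗[k] A, counit (R := k) (contract g x) =
      g (TensorProduct.lid k A ((counit (R := k)).rTensor A x)) := by
    intro x
    induction x using TensorProduct.induction_on with
    | zero => simp
    | add x y hx hy => simp only [map_add, hx, hy]
    | tmul a b => simp [mul_comm]
  rw [translate, LinearMap.comp_apply, h, rTensor_counit_comul]
  simp

theorem comul_translate (g : A →ₗ[k] k) (a : A) :
    comul (R := k) (translate g a) = (translate g).lTensor A (comul a) := by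
  have h : ∀ x : A ⊗[k] A, comul (R := k) (contract g x) =
      (contract g).lTensor A (TensorProduct.assoc k A A A (comul.rTensor A x)) := by
    intro x
    induction x using TensorProduct.induction_on with
    | zero => simp
    | add x y hx hy => simp only [map_add, hx, hy]
    | tmul a b =>
      simp only [contract_tmul, map_smul, LinearMap.rTensor_tmul]
      generalize comul (R := k) a = y
      induction y using TensorProduct.induction_on with
      | zero => simp
      | add x y hx hy => simp only [TensorProduct.add_tmul, map_add, smul_add, hx, hy]
      | tmul c d => simp
  rw [translate, LinearMap.comp_apply, h, coassoc_apply, LinearMap.lTensor_comp,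
    LinearMap.comp_apply]

theorem translate_translate (g f : A →ₗ[k] k) (a : A) :
    translate g (translate f a) = translate (g ∘ₗ translate f) a := by
  conv_lhs => rw [translate, LinearMap.comp_apply, comul_translate, contract_comp]
  rfl

end Translate

/-! ### A functional with finite-dimensional translate gives an integral -/

section Criterion

variable {k : Type u} {A : Type v} [Field k] [Ring A] [Algebra k A]
variable (𝒜 : ZMod 2 → Submodule k A) [GradedAlgebra 𝒜]

/-- The sign `(-1) ^ p`. -/
def paritySign (p : ZMod 2) : ℤ := if p = 0 then 1 else -1

theorem units_pow_eq_paritySign (p : ZMod 2) : (((-1 : ℤˣ) ^ p : ℤˣ) : ℤ) = paritySign p := by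
  have h : ∀ i : ZMod 2, i = 0 ∨ i = 1 := by decide
  rcases h p with rfl | rfl
  · rw [uzpow_zero]; rfl
  · rw [uzpow_one]; rfl

theorem mul_comm_paritySign [SuperCommutative 𝒜] {p q : ZMod 2} {a b : A} (ha : a ∈ 𝒜 p)
    (hb : b ∈ 𝒜 q) : a * b = paritySign (p * q) • (b * a) := by
  have h : ∀ i : ZMod 2, i = 0 ∨ i = 1 := by decide
  rcases h p with rfl | rfl
  · simp [paritySign, SuperCommutative.even_comm a ha b]
  · rcases h q with rfl | rfl
    · simp [paritySign, SuperCommutative.even_comm b hb a]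
    · simp [paritySign, SuperCommutative.odd_anticomm a ha b hb]

theorem tensorDegree_induction {q : ZMod 2} {P : A ⊗[k] A → Prop} {x : A ⊗[k] A}
    (hx : x ∈ tensorDegree k 𝒜 q) (zero : P 0) (add : ∀ x y, P x → P y → P (x + y))
    (tmul : ∀ r s : ZMod 2, r + s = q → ∀ a ∈ 𝒜 r, ∀ b ∈ 𝒜 s, P (a ⊗ₜ b)) : P x := by
  refine Submodule.iSup_induction _ (motive := P) hx (fun r y hy => ?_) zero add
  refine Submodule.iSup_induction _ (motive := P) hy (fun s z hz => ?_) zero add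
  refine Submodule.iSup_induction _ (motive := P) hz (fun hrs w hw => ?_) zero add
  obtain ⟨t, rfl⟩ := hw
  induction t using TensorProduct.induction_on with
  | zero => simpa using zero
  | add x y hx hy => rw [map_add]; exact add _ _ hx hy
  | tmul a b => exact tmul r s hrs a a.2 b b.2

variable [Coalgebra k A] [SuperHopfAlgebra k 𝒜]

theorem translate_mem {p : ZMod 2} {g : A →ₗ[k] k} (hg : ∀ a ∈ 𝒜 (p + 1), g a = 0) {q : ZMod 2}
    {a : A} (ha : a ∈ 𝒜 q) : translate g a ∈ 𝒜 (q + p) := by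
  refine tensorDegree_induction 𝒜 (P := fun x => contract g x ∈ 𝒜 (q + p))
    (SuperHopfAlgebra.comul_mem q a ha) (by simp) ?_ ?_
  · intro x y hx hy
    rw [map_add]
    exact add_mem hx hy
  · intro r s hrs a ha b hb
    rw [contract_tmul]
    have h : ∀ s p : ZMod 2, s = p ∨ s = p + 1 := by decide
    rcases h s p with rfl | rfl
    · have h2 : q + s = r := by
        rw [← hrs, add_assoc, CharTwo.add_self_eq_zero, add_zero]
      rw [h2]
      exact Submodule.smul_mem _ _ ha
    · rw [hg b hb, zero_smul]
      exact zero_mem _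

/-- Contracting a super product `(u ⊗ a) Δ(h)` against a homogeneous functional of degree `t`: only
the components of `Δ(h)` of one bidegree contribute, so that a single sign appears. -/
theorem contract_mul_comul {t r q : ZMod 2} {g : A →ₗ[k] k} (hg : ∀ a ∈ 𝒜 (t + 1), g a = 0)
    (u : A) {a : A} (ha : a ∈ 𝒜 r) {h : A} (hh : h ∈ 𝒜 q) :
    contract g ((GradedTensorProduct.of k 𝒜 𝒜).symm
      (GradedTensorProduct.of k 𝒜 𝒜 (u ⊗ₜ a) * GradedTensorProduct.of k 𝒜 𝒜 (comul h))) =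
    paritySign (r * (q + r + t)) • (u * translate (g ∘ₗ LinearMap.mulLeft k a) h) := by
  refine tensorDegree_induction 𝒜 (P := fun x => contract g ((GradedTensorProduct.of k 𝒜 𝒜).symm
      (GradedTensorProduct.of k 𝒜 𝒜 (u ⊗ₜ a) * GradedTensorProduct.of k 𝒜 𝒜 x)) =
    paritySign (r * (q + r + t)) • (u * contract (g ∘ₗ LinearMap.mulLeft k a) x))
    (SuperHopfAlgebra.comul_mem q h hh) (by simp) ?_ ?_
  · intro x y hx hy
    simp only [map_add, mul_add, smul_add, hx, hy]
  · intro v w hvw b hb c hc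
    have hm := GradedTensorProduct.tmul_coe_mul_coe_tmul (R := k) 𝒜 𝒜 u ⟨a, ha⟩ ⟨b, hb⟩ c
    simp only at hm
    rw [hm, Units.smul_def, units_pow_eq_paritySign]
    simp only [map_zsmul, LinearEquiv.symm_apply_apply, contract_tmul, LinearMap.comp_apply,
      LinearMap.mulLeft_apply, mul_smul_comm]
    by_cases hd : r + w = t
    · have h2 : v = q + r + t := by
        rw [← hd, ← hvw]
        linear_combination (-w - r) * (CharTwo.two_eq_zero : (2 : ZMod 2) = 0)
      rw [h2]
    · have h3 : ∀ x y : ZMod 2, x ≠ y → x = y + 1 := by decide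
      have h4 : g (a * c) = 0 := hg _ (h3 _ _ hd ▸ SetLike.mul_mem_graded ha hc)
      rw [h4]
      simp

theorem sum_antipode_mul {ι : Type*} [Fintype ι] {c : A} (x y : ι → A)
    (hc : comul (R := k) c = ∑ i, x i ⊗ₜ y i) :
    ∑ i, SuperHopfAlgebra.antipode (k := k) 𝒜 (x i) * y i = algebraMap k A (counit c) := by
  have h := congr($(SuperHopfAlgebra.mul_antipode_rTensor_comul (k := k) (𝒜 := 𝒜)) c)
  simpa [hc] using h

theorem sum_mul_antipode {ι : Type*} [Fintype ι] {c : A} (x y : ι → A)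
    (hc : comul (R := k) c = ∑ i, x i ⊗ₜ y i) :
    ∑ i, x i * SuperHopfAlgebra.antipode (k := k) 𝒜 (y i) = algebraMap k A (counit c) := by
  have h := congr($(SuperHopfAlgebra.mul_antipode_lTensor_comul (k := k) (𝒜 := 𝒜)) c)
  simpa [hc] using h

/-- The signs in the matrix computation of `hasIntegral_of_matrix` combine to one that does not
depend on the summation index `i`. -/
theorem paritySign_identity : ∀ i j m q l : ZMod 2, l = j + m + q →
    paritySign i * (paritySign ((j + i) * (q + (j + i) + i)) * paritySign ((m + i) * (i + l))) =
      if q = j then paritySign m else paritySign j := by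
  decide

/-- Matrix coefficients `c` of a finite-dimensional comodule, together with the coordinates `φ` of
a comodule map from `A` to it, produce integrals: the supertraces
`h ↦ ∑ i, (-1) ^ |i| φ_i(c_{ji} h)`. -/
theorem hasIntegral_of_matrix [SuperCommutative 𝒜] {ι : Type*} [Fintype ι] [DecidableEq ι]
    (p : ι → ZMod 2) (φ : ι → A →ₗ[k] k) (c : ι → ι → A)
    (hφ : ∀ i, ∀ a ∈ 𝒜 (p i + 1), φ i a = 0) (hc : ∀ i j, c i j ∈ 𝒜 (p j + p i))
    (htr : ∀ i a, translate (φ i) a = ∑ j, φ j a • c i j)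
    (hcomul : ∀ i j, comul (R := k) (c i j) = ∑ m, c m j ⊗ₜ c i m)
    (hcounit : ∀ i j, counit (R := k) (c i j) = if i = j then 1 else 0)
    (hne : ∃ i, φ i ≠ 0) : HasIntegral k A := by
  let S := SuperHopfAlgebra.antipode (k := k) 𝒜
  have hSc : ∀ i j, ∑ m, S (c m j) * c i m = if i = j then 1 else 0 := by
    intro i j
    rw [sum_antipode_mul 𝒜 _ _ (hcomul i j), hcounit]
    split_ifs <;> simp
  have hcS : ∀ i j, ∑ m, c m j * S (c i m) = if i = j then 1 else 0 := by
    intro i j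
    rw [sum_mul_antipode 𝒜 _ _ (hcomul i j), hcounit]
    split_ifs <;> simp
  let ψ : ι → A →ₗ[k] k := fun j => ∑ i, paritySign (p i) • (φ i ∘ₗ LinearMap.mulLeft k (c j i))
  have hψ : ∀ j h, ψ j h = ∑ i, paritySign (p i) • φ i (c j i * h) := by
    intro j h
    simp [ψ]
  have hT : ∀ j h, translate (ψ j) h =
      ∑ i, paritySign (p i) • translate (φ i ∘ₗ LinearMap.mulLeft k (c j i)) h := by
    intro j h
    have : ∀ x : A ⊗[k] A, contract (ψ j) x =
        ∑ i, paritySign (p i) • contract (φ i ∘ₗ LinearMap.mulLeft k (c j i)) x := by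
      intro x
      induction x using TensorProduct.induction_on with
      | zero => simp
      | add x y hx hy => simp only [map_add, smul_add, Finset.sum_add_distrib, hx, hy]
      | tmul a b =>
        simp only [contract_tmul, hψ, Finset.sum_smul, LinearMap.comp_apply,
          LinearMap.mulLeft_apply, smul_assoc]
    exact this _
  -- the coefficients of the translate of `φ i` at `c j m * h`, computed in two ways
  have h1 : ∀ (q : ZMod 2) (h : A), h ∈ 𝒜 q → ∀ i j m,
      ∑ n, paritySign ((p j + p n) * (q + (p j + p n) + p i)) •
        (c n m * translate (φ i ∘ₗ LinearMap.mulLeft k (c j n)) h) =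
      ∑ l, φ l (c j m * h) • c i l := by
    intro q h hh i j m
    have hcm : translate (φ i) (c j m * h) =
        ∑ n, contract (φ i) ((GradedTensorProduct.of k 𝒜 𝒜).symm
          (GradedTensorProduct.of k 𝒜 𝒜 (c n m ⊗ₜ c j n) *
            GradedTensorProduct.of k 𝒜 𝒜 (comul h))) := by
      rw [translate, LinearMap.comp_apply,
        ← (GradedTensorProduct.of k 𝒜 𝒜).symm_apply_apply (comul (c j m * h)),
        SuperHopfAlgebra.comul_mul, hcomul]
      simp only [map_sum, Finset.sum_mul]
    rw [← htr, hcm]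
    refine Finset.sum_congr rfl fun n _ => ?_
    rw [contract_mul_comul 𝒜 (hφ i) (c n m) (add_comm (p n) (p j) ▸ hc j n) hh]
  -- inverting the matrix `c` isolates the term with `n = i`
  have h2 : ∀ (q : ZMod 2) (h : A), h ∈ 𝒜 q → ∀ i j,
      paritySign ((p j + p i) * (q + (p j + p i) + p i)) •
        translate (φ i ∘ₗ LinearMap.mulLeft k (c j i)) h =
      ∑ m, ∑ l, φ l (c j m * h) • (S (c m i) * c i l) := by
    intro q h hh i j
    have h3 := congr(∑ m, S (c m i) * $(funext (h1 q h hh i j)) m)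
    simp only [Finset.mul_sum, mul_smul_comm, ← mul_assoc] at h3
    rw [← h3, Finset.sum_comm]
    simp only [← Finset.smul_sum, ← Finset.sum_mul, hSc]
    simp
  have hsq : ∀ (x : ZMod 2), paritySign x * paritySign x = 1 := by decide
  have h3 : ∀ (q : ZMod 2) (h : A), h ∈ 𝒜 q → ∀ j, translate (ψ j) h = ψ j h • (1 : A) := by
    intro q h hh j
    let e : ι → ℤ := fun m => if q = p j then paritySign (p m) else paritySign (p j)
    have h4 : ∀ m l i, (paritySign (p i) * paritySign ((p j + p i) * (q + (p j + p i) + p i))) •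
        (φ l (c j m * h) • (S (c m i) * c i l)) =
        φ l (c j m * h) • (e m • (c i l * S (c m i))) := by
      intro m l i
      by_cases hl : p l = p j + p m + q
      · have hS : S (c m i) ∈ 𝒜 (p i + p m) := SuperHopfAlgebra.antipode_mem _ _ (hc m i)
        rw [mul_comm_paritySign 𝒜 hS (hc i l), smul_comm _ (φ l (c j m * h)), smul_smul,
          add_comm (p i) (p m), add_comm (p l) (p i), mul_assoc,
          paritySign_identity _ _ _ _ _ hl]
      · have h5 : ∀ x y z w : ZMod 2, w ≠ x + y + z → y + x + z = w + 1 := by decide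
        have h6 : φ l (c j m * h) = 0 := hφ l _ (by
          rw [← h5 _ _ _ _ hl]
          exact SetLike.mul_mem_graded (hc j m) hh)
        rw [h6, zero_smul, zero_smul, smul_zero]
    calc translate (ψ j) h
        = ∑ i, ∑ m, ∑ l,
          (paritySign (p i) * paritySign ((p j + p i) * (q + (p j + p i) + p i))) •
            (φ l (c j m * h) • (S (c m i) * c i l)) := by
          rw [hT]
          refine Finset.sum_congr rfl fun i _ => ?_
          simp only [mul_smul, ← Finset.smul_sum]
          rw [← h2 q h hh i j, smul_smul (paritySign ((p j + p i) * _)), hsq, one_smul]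
      _ = ∑ m, ∑ l, φ l (c j m * h) • (e m • ∑ i, c i l * S (c m i)) := by
          simp only [h4, Finset.smul_sum]
          rw [Finset.sum_comm]
          refine Finset.sum_congr rfl fun m _ => ?_
          rw [Finset.sum_comm]
      _ = ∑ m, φ m (c j m * h) • (e m • (1 : A)) := by
          simp [hcS]
      _ = ψ j h • (1 : A) := by
          rw [hψ, Finset.sum_smul]
          refine Finset.sum_congr rfl fun m _ => ?_
          by_cases hq : q = p j
          · simp only [e, if_pos hq]
            rw [smul_comm, smul_assoc]
          · have h5 : ∀ x y z : ZMod 2, x ≠ y → z + y + x = z + 1 := by decide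
            have h6 : φ m (c j m * h) = 0 := hφ m _ (by
              rw [← h5 _ _ _ hq]
              exact SetLike.mul_mem_graded (hc j m) hh)
            rw [h6, zero_smul, smul_zero, zero_smul]
  rw [hasIntegral_iff]
  by_contra! hcon
  obtain ⟨l, hl⟩ := hne
  have hψ0 : ∀ j, ψ j = 0 := by
    intro j
    by_contra h0
    obtain ⟨a, ha⟩ := hcon (ψ j) h0
    obtain ⟨b, hb, d, hd, rfl⟩ := exists_even_add_odd 𝒜 a
    exact ha (by rw [map_add, map_add, add_smul, h3 _ _ hb, h3 _ _ hd])
  -- the integrals `ψ j` determine `φ l`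
  have h7 : ∀ h, ∑ j, ψ j (S (c l j) * h) = paritySign (p l) • φ l h := by
    intro h
    simp only [hψ]
    rw [Finset.sum_comm]
    simp only [← Finset.smul_sum, ← map_sum, ← mul_assoc, ← Finset.sum_mul, hcS]
    rw [Finset.sum_eq_single l (fun i _ hi => by simp [hi.symm]) (by simp)]
    simp
  apply hl
  ext h
  have h8 := h7 h
  simp only [hψ0, LinearMap.zero_apply, Finset.sum_const_zero] at h8
  have h9 := congr(paritySign (p l) • $h8)
  rw [smul_smul, hsq, one_smul, smul_zero] at h9
  simpa using h9.symm

/-- A finite-dimensional graded subspace has a homogeneous basis with homogeneous dual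
functionals on the whole algebra. -/
theorem exists_homogeneous_dual_basis (D : Submodule k A) [Module.Finite k D]
    (hD : ∀ i, ∀ a ∈ D, GradedAlgebra.proj 𝒜 i a ∈ D) :
    ∃ (n : ZMod 2 → ℕ) (b : (Σ q, Fin (n q)) → A) (ξ : (Σ q, Fin (n q)) → A →ₗ[k] k),
      (∀ i, b i ∈ D) ∧ (∀ i, b i ∈ 𝒜 i.1) ∧ (∀ i, ∀ a ∈ 𝒜 (i.1 + 1), ξ i a = 0) ∧
      (∀ i j, ξ i (b j) = if i = j then 1 else 0) ∧ ∀ a ∈ D, a = ∑ i, ξ i a • b i := by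
  let E : ZMod 2 → Submodule k A := fun q => D ⊓ 𝒜 q
  have hE : ∀ q, Module.Finite k (E q) := fun q =>
    Submodule.finiteDimensional_of_le (inf_le_left : E q ≤ D)
  let β : ∀ q, Module.Basis (Fin (Module.finrank k (E q))) k (E q) := fun q =>
    Module.finBasis k (E q)
  choose g hg using fun (q : ZMod 2) (r : Fin (Module.finrank k (E q))) =>
    LinearMap.exists_extend ((β q).coord r)
  have hg' : ∀ q r (x : E q), g q r x = (β q).repr x r := fun q r x =>
    congr($(hg q r) x)
  have hodd : ∀ q : ZMod 2, q + 1 ≠ q := by decide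
  refine ⟨fun q => Module.finrank k (E q), fun i => β i.1 i.2,
    fun i => g i.1 i.2 ∘ₗ GradedAlgebra.proj 𝒜 i.1, fun i => (β i.1 i.2).2.1,
    fun i => (β i.1 i.2).2.2, ?_, ?_, ?_⟩
  · intro i a ha
    rw [LinearMap.comp_apply, proj_ne 𝒜 ha (hodd _), map_zero]
  · rintro ⟨q, r⟩ ⟨q', r'⟩
    rw [LinearMap.comp_apply]
    by_cases hq : q' = q
    · subst hq
      rw [proj_same 𝒜 (β q' r').2.2, hg', Module.Basis.repr_self, Finsupp.single_apply]
      simp [eq_comm]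
    · rw [proj_ne 𝒜 (β q' r').2.2 hq, map_zero, if_neg]
      rintro ⟨⟩
      exact hq rfl
  · intro a ha
    rw [Fintype.sum_sigma]
    have h : ∀ q : ZMod 2, ∑ r, (g q r ∘ₗ GradedAlgebra.proj 𝒜 q) a • (β q r : A) =
        GradedAlgebra.proj 𝒜 q a := by
      intro q
      have hm : GradedAlgebra.proj 𝒜 q a ∈ E q := ⟨hD q a ha, proj_mem 𝒜 q a⟩
      have h2 := congr(($((β q).sum_repr ⟨_, hm⟩) : A))
      simp only [← hg', Submodule.coe_sum, Submodule.coe_smul] at h2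
      exact h2
    simp only [h]
    exact ((Fin.sum_univ_two (fun q : ZMod 2 => GradedAlgebra.proj 𝒜 q a)).trans
      (proj_add_proj 𝒜 a)).symm

/-- A nonzero functional `f` vanishing on the odd part whose translates `∑ f(a₂) a₁` span a
finite-dimensional space gives an integral. -/
theorem hasIntegral_of_finite_range [SuperCommutative 𝒜] {f : A →ₗ[k] k} (hf : f ≠ 0)
    (hodd : ∀ a ∈ 𝒜 1, f a = 0) (hfin : (LinearMap.range (translate f)).FG) :
    HasIntegral k A := by
  classical
  have hmem : ∀ q a, a ∈ 𝒜 q → translate f a ∈ 𝒜 q := by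
    intro q a ha
    simpa using translate_mem 𝒜 (p := 0) (by simpa using hodd) ha
  have : Module.Finite k (LinearMap.range (translate f)) := Module.Finite.iff_fg.mpr hfin
  have hproj : ∀ q a, GradedAlgebra.proj 𝒜 q (translate f a) =
      translate f (GradedAlgebra.proj 𝒜 q a) := by
    intro q a
    have h : ∀ i : ZMod 2, ∀ b ∈ 𝒜 i, GradedAlgebra.proj 𝒜 q (translate f b) =
      translate f (GradedAlgebra.proj 𝒜 q b) := by
      intro i b hb
      by_cases hi : i = q
      · subst hi
        rw [proj_same 𝒜 (hmem _ _ hb), proj_same 𝒜 hb]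
      · rw [proj_ne 𝒜 (hmem _ _ hb) hi, proj_ne 𝒜 hb hi, map_zero]
    obtain ⟨b, hb, c, hc, rfl⟩ := exists_even_add_odd 𝒜 a
    simp only [map_add, h _ _ hb, h _ _ hc]
  obtain ⟨n, b, ξ, hbD, hb, hξ, hξb, hsum⟩ := exists_homogeneous_dual_basis 𝒜
    (LinearMap.range (translate f)) (by
      rintro q _ ⟨a, rfl⟩
      exact ⟨_, (hproj q a).symm⟩)
  choose a ha using hbD
  have htr : ∀ i x, translate (ξ i ∘ₗ translate f) x =
      ∑ j, ξ j (translate f x) • translate (ξ i) (b j) := by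
    intro i x
    rw [← translate_translate]
    conv_lhs => rw [hsum _ ⟨x, rfl⟩]
    rw [map_sum]
    simp only [map_smul]
  have hcomul : ∀ j, comul (R := k) (b j) = ∑ m, translate (ξ m) (b j) ⊗ₜ b m := by
    intro j
    have h : ∀ x : A ⊗[k] A, (translate f).lTensor A x =
        ∑ m, contract (ξ m ∘ₗ translate f) x ⊗ₜ b m := by
      intro x
      induction x using TensorProduct.induction_on with
      | zero => simp
      | add x y hx hy => simp only [map_add, TensorProduct.add_tmul, Finset.sum_add_distrib, hx, hy]
      | tmul x y =>
        rw [LinearMap.lTensor_tmul, hsum _ ⟨y, rfl⟩, TensorProduct.tmul_sum]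
        refine Finset.sum_congr rfl fun m _ => ?_
        rw [contract_tmul, LinearMap.comp_apply, TensorProduct.tmul_smul, TensorProduct.smul_tmul']
    rw [← ha j, comul_translate, h]
    refine Finset.sum_congr rfl fun m _ => ?_
    rw [translate_translate]
    rfl
  refine hasIntegral_of_matrix 𝒜 (fun i => i.1) (fun i => ξ i ∘ₗ translate f)
    (fun i j => translate (ξ i) (b j)) ?_ (fun i j => translate_mem 𝒜 (hξ i) (hb j)) htr ?_ ?_ ?_
  · exact fun i x hx => hξ i _ (hmem _ _ hx)
  · intro i j
    rw [comul_translate, hcomul, map_sum]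
    rfl
  · intro i j
    rw [counit_translate, hξb]
  · by_contra! h
    apply hf
    ext x
    rw [← counit_translate f x, hsum _ ⟨x, rfl⟩, Finset.sum_eq_zero fun i _ => ?_]
    · simp
    · have := congr($(h i) x)
      rw [LinearMap.comp_apply] at this
      rw [this, LinearMap.zero_apply, zero_smul]

end Criterion

/-! ### The coactions of `A / (A_1)` on `A` -/

section Coaction

variable {k : Type u} {A : Type v} [Field k] [Ring A] [Algebra k A]
variable (𝒜 : ZMod 2 → Submodule k A) [GradedAlgebra 𝒜]

theorem map₂_mk_mul_le {R B C : Type*} [CommRing R] [Ring B] [Algebra R B] [Ring C] [Algebra R C]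
    (P P' : Submodule R B) (Q Q' : Submodule R C) :
    Submodule.map₂ (TensorProduct.mk R B C) P Q * Submodule.map₂ (TensorProduct.mk R B C) P' Q' ≤
      Submodule.map₂ (TensorProduct.mk R B C) (P * P') (Q * Q') := by
  rw [Submodule.map₂_eq_span_image2 _ P, Submodule.map₂_eq_span_image2 _ P',
    Submodule.span_mul_span, Submodule.span_le]
  rintro _ ⟨_, ⟨a, ha, b, hb, rfl⟩, _, ⟨c, hc, d, hd, rfl⟩, rfl⟩
  simp only [TensorProduct.mk_apply, Algebra.TensorProduct.tmul_mul_tmul]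
  exact Submodule.apply_mem_map₂ _ (Submodule.mul_mem_mul ha hc) (Submodule.mul_mem_mul hb hd)

theorem map₂_mk_pow_le {R B C : Type*} [CommRing R] [Ring B] [Algebra R B] [Ring C] [Algebra R C]
    (P : Submodule R B) (Q : Submodule R C) (j : ℕ) :
    Submodule.map₂ (TensorProduct.mk R B C) P Q ^ j ≤
      Submodule.map₂ (TensorProduct.mk R B C) (P ^ j) (Q ^ j) := by
  induction j with
  | zero =>
    rw [pow_zero, Submodule.one_le]
    exact Submodule.apply_mem_map₂ _ (Submodule.one_le.mp le_rfl) (Submodule.one_le.mp le_rfl)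
  | succ j ih =>
    rw [pow_succ, pow_succ, pow_succ]
    exact (mul_le_mul' ih le_rfl).trans (map₂_mk_mul_le _ _ _ _)

theorem map₂_mk_top {R B C : Type*} [CommRing R] [Ring B] [Algebra R B] [Ring C] [Algebra R C] :
    Submodule.map₂ (TensorProduct.mk R B C) ⊤ ⊤ = ⊤ := by
  refine eq_top_iff.mpr fun x _ => ?_
  induction x using TensorProduct.induction_on with
  | zero => exact zero_mem _
  | add x y hx hy => exact add_mem (hx trivial) (hy trivial)
  | tmul a b => exact Submodule.apply_mem_map₂ _ Submodule.mem_top Submodule.mem_top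

/-- The algebra map `A ⊗ A → A ⊗ A / (A_1)` from the super tensor product. -/
def gradedTensorToRight :
    GradedTensorProduct k 𝒜 𝒜 →ₐ[k] A ⊗[k] EvenQuotient 𝒜 :=
  GradedTensorProduct.lift 𝒜 𝒜 Algebra.TensorProduct.includeLeft
    (Algebra.TensorProduct.includeRight.comp (evenMk 𝒜)) (by
      intro i j a b
      have h : ∀ i : ZMod 2, i = 0 ∨ i = 1 := by decide
      rcases h j with rfl | rfl
      · simp
      · have hb := evenMk_odd b.2
        simp only [AlgHom.comp_apply, hb, map_zero, zero_mul, mul_zero, smul_zero])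

/-- The algebra map `A ⊗ A → A / (A_1) ⊗ A` from the super tensor product. -/
def gradedTensorToLeft :
    GradedTensorProduct k 𝒜 𝒜 →ₐ[k] EvenQuotient 𝒜 ⊗[k] A :=
  GradedTensorProduct.lift 𝒜 𝒜 (Algebra.TensorProduct.includeLeft.comp (evenMk 𝒜))
    Algebra.TensorProduct.includeRight (by
      intro i j a b
      have h : ∀ i : ZMod 2, i = 0 ∨ i = 1 := by decide
      rcases h i with rfl | rfl
      · simp
      · have ha := evenMk_odd a.2
        simp only [AlgHom.comp_apply, ha, map_zero, zero_mul, mul_zero, smul_zero])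

theorem gradedTensorToRight_of (x : A ⊗[k] A) :
    gradedTensorToRight 𝒜 (GradedTensorProduct.of k 𝒜 𝒜 x) =
      (evenMk 𝒜).toLinearMap.lTensor A x := by
  induction x using TensorProduct.induction_on with
  | zero => simp
  | add x y hx hy => simp only [map_add, hx, hy]
  | tmul a b =>
    refine (GradedTensorProduct.lift_tmul 𝒜 𝒜 _ _ _ a b).trans ?_
    simp

theorem gradedTensorToLeft_of (x : A ⊗[k] A) :
    gradedTensorToLeft 𝒜 (GradedTensorProduct.of k 𝒜 𝒜 x) =
      (evenMk 𝒜).toLinearMap.rTensor A x := by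
  induction x using TensorProduct.induction_on with
  | zero => simp
  | add x y hx hy => simp only [map_add, hx, hy]
  | tmul a b =>
    refine (GradedTensorProduct.lift_tmul 𝒜 𝒜 _ _ _ a b).trans ?_
    simp

variable [Coalgebra k A] [SuperHopfAlgebra k 𝒜]

/-- The right coaction `a ↦ ∑ a₁ ⊗ π(a₂)` of `A / (A_1)` on `A`. It is multiplicative for the
ordinary product of the tensor product, since `A / (A_1)` is purely even. -/
def rightCoaction : A →ₐ[k] A ⊗[k] EvenQuotient 𝒜 :=
  AlgHom.ofLinearMap ((evenMk 𝒜).toLinearMap.lTensor A ∘ₗ comul)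
    (by
      rw [LinearMap.comp_apply, ← gradedTensorToRight_of, SuperHopfAlgebra.comul_one, map_one])
    (by
      intro a b
      simp only [LinearMap.comp_apply]
      rw [← gradedTensorToRight_of, SuperHopfAlgebra.comul_mul, map_mul, gradedTensorToRight_of,
        gradedTensorToRight_of])

/-- The left coaction `a ↦ ∑ π(a₁) ⊗ a₂` of `A / (A_1)` on `A`. -/
def leftCoaction : A →ₐ[k] EvenQuotient 𝒜 ⊗[k] A :=
  AlgHom.ofLinearMap ((evenMk 𝒜).toLinearMap.rTensor A ∘ₗ comul)
    (by
      rw [LinearMap.comp_apply, ← gradedTensorToLeft_of, SuperHopfAlgebra.comul_one, map_one])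
    (by
      intro a b
      simp only [LinearMap.comp_apply]
      rw [← gradedTensorToLeft_of, SuperHopfAlgebra.comul_mul, map_mul, gradedTensorToLeft_of,
        gradedTensorToLeft_of])

theorem rightCoaction_apply (a : A) :
    rightCoaction 𝒜 a = (evenMk 𝒜).toLinearMap.lTensor A (comul a) := rfl

theorem leftCoaction_apply (a : A) :
    leftCoaction 𝒜 a = (evenMk 𝒜).toLinearMap.rTensor A (comul a) := rfl

theorem rightCoaction_odd {a : A} (ha : a ∈ 𝒜 1) :
    rightCoaction 𝒜 a ∈ Submodule.map₂ (TensorProduct.mk k A (EvenQuotient 𝒜)) (𝒜 1) ⊤ := by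
  rw [rightCoaction_apply]
  refine tensorDegree_induction 𝒜 (SuperHopfAlgebra.comul_mem 1 a ha)
    (P := fun x => (evenMk 𝒜).toLinearMap.lTensor A x ∈
      Submodule.map₂ (TensorProduct.mk k A (EvenQuotient 𝒜)) (𝒜 1) ⊤) (by simp) ?_ ?_
  · intro x y hx hy
    rw [map_add]
    exact add_mem hx hy
  · intro r s hrs a ha b hb
    have hc : ∀ r s : ZMod 2, r + s = 1 → r = 1 ∨ s = 1 := by decide
    rw [LinearMap.lTensor_tmul]
    rcases hc r s hrs with rfl | rfl
    · exact Submodule.apply_mem_map₂ _ ha Submodule.mem_top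
    · rw [AlgHom.toLinearMap_apply, evenMk_odd hb, TensorProduct.tmul_zero]
      exact zero_mem _

theorem leftCoaction_odd {a : A} (ha : a ∈ 𝒜 1) :
    leftCoaction 𝒜 a ∈ Submodule.map₂ (TensorProduct.mk k (EvenQuotient 𝒜) A) ⊤ (𝒜 1) := by
  rw [leftCoaction_apply]
  refine tensorDegree_induction 𝒜 (SuperHopfAlgebra.comul_mem 1 a ha)
    (P := fun x => (evenMk 𝒜).toLinearMap.rTensor A x ∈
      Submodule.map₂ (TensorProduct.mk k (EvenQuotient 𝒜) A) ⊤ (𝒜 1)) (by simp) ?_ ?_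
  · intro x y hx hy
    rw [map_add]
    exact add_mem hx hy
  · intro r s hrs a ha b hb
    have hc : ∀ r s : ZMod 2, r + s = 1 → s = 1 ∨ r = 1 := by decide
    rw [LinearMap.rTensor_tmul]
    rcases hc r s hrs with rfl | rfl
    · exact Submodule.apply_mem_map₂ _ Submodule.mem_top hb
    · rw [AlgHom.toLinearMap_apply, evenMk_odd ha, TensorProduct.zero_tmul]
      exact zero_mem _

theorem rightCoaction_mem {j : ℕ} {a : A} (ha : a ∈ oddFiltration 𝒜 j) :
    rightCoaction 𝒜 a ∈
      Submodule.map₂ (TensorProduct.mk k A (EvenQuotient 𝒜)) (oddFiltration 𝒜 j) ⊤ := by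
  have h : Submodule.map (rightCoaction 𝒜).toLinearMap (oddFiltration 𝒜 j) ≤
      Submodule.map₂ (TensorProduct.mk k A (EvenQuotient 𝒜)) (oddFiltration 𝒜 j) ⊤ := by
    rw [oddFiltration, Submodule.map_mul, Submodule.map_pow]
    have h1 : Submodule.map (rightCoaction 𝒜).toLinearMap (𝒜 1) ≤
        Submodule.map₂ (TensorProduct.mk k A (EvenQuotient 𝒜)) (𝒜 1) ⊤ :=
      Submodule.map_le_iff_le_comap.mpr fun a ha => rightCoaction_odd 𝒜 ha
    have h2 := (pow_le_pow_left' h1 j).trans (map₂_mk_pow_le _ _ j)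
    refine (mul_le_mul' (le_top.trans map₂_mk_top.ge) h2).trans ((map₂_mk_mul_le _ _ _ _).trans ?_)
    exact Submodule.map₂_le_map₂_right le_top
  exact h ⟨a, ha, rfl⟩

theorem leftCoaction_mem {j : ℕ} {a : A} (ha : a ∈ oddFiltration 𝒜 j) :
    leftCoaction 𝒜 a ∈
      Submodule.map₂ (TensorProduct.mk k (EvenQuotient 𝒜) A) ⊤ (oddFiltration 𝒜 j) := by
  have h : Submodule.map (leftCoaction 𝒜).toLinearMap (oddFiltration 𝒜 j) ≤
      Submodule.map₂ (TensorProduct.mk k (EvenQuotient 𝒜) A) ⊤ (oddFiltration 𝒜 j) := by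
    rw [oddFiltration, Submodule.map_mul, Submodule.map_pow]
    have h1 : Submodule.map (leftCoaction 𝒜).toLinearMap (𝒜 1) ≤
        Submodule.map₂ (TensorProduct.mk k (EvenQuotient 𝒜) A) ⊤ (𝒜 1) :=
      Submodule.map_le_iff_le_comap.mpr fun a ha => leftCoaction_odd 𝒜 ha
    have h2 := (pow_le_pow_left' h1 j).trans (map₂_mk_pow_le _ _ j)
    refine (mul_le_mul' (le_top.trans map₂_mk_top.ge) h2).trans ((map₂_mk_mul_le _ _ _ _).trans ?_)
    exact Submodule.map₂_le_map₂_left le_top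
  exact h ⟨a, ha, rfl⟩

end Coaction

/-! ### From `A / (A_1)` to `A`: the coinvariants are finite-dimensional -/

section Coinvariants

variable {k : Type u} {A : Type v} [Field k] [Ring A] [Algebra k A]
variable (𝒜 : ZMod 2 → Submodule k A) [GradedAlgebra 𝒜]
variable [Coalgebra k A] [SuperHopfAlgebra k 𝒜] [SuperCommutative 𝒜]

/-- The coinvariants of the right coaction of `A / (A_1)` on `A`, that is, the functions on the
quotient of the super group by its even part. -/
def rightCoinvariants : Submodule k A :=
  LinearMap.eqLocus (rightCoaction 𝒜).toLinearMap
    (Algebra.TensorProduct.includeLeft : A →ₐ[k] A ⊗[k] EvenQuotient 𝒜).toLinearMap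

/-- The linear map `a ↦ T(y) a` on `a ⊗ y`, for a linear map `T : A / (A_1) → A`. -/
def liftedMul (T : EvenQuotient 𝒜 →ₗ[k] A) : A ⊗[k] EvenQuotient 𝒜 →ₗ[k] A :=
  TensorProduct.lift ((LinearMap.mul k A).flip.compl₂ T)

theorem liftedMul_tmul (T : EvenQuotient 𝒜 →ₗ[k] A) (a : A) (y : EvenQuotient 𝒜) :
    liftedMul 𝒜 T (a ⊗ₜ y) = T y * a := rfl

variable {𝒜} in
theorem evenMk_eq_zero_iff {a : A} : evenMk 𝒜 a = 0 ↔ a ∈ oddIdeal 𝒜 :=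
  Ideal.Quotient.eq_zero_iff_mem

/-- `∑ S(π(a₂)) π(a₁) = ε(a)`, as `A / (A_1)` is commutative. -/
theorem evenMk_liftedMul_rightCoaction {T : EvenQuotient 𝒜 →ₗ[k] A}
    (hT : ∀ y, evenMk 𝒜 (T y) = HopfAlgebra.antipode k y) (a : A) :
    evenMk 𝒜 (liftedMul 𝒜 T (rightCoaction 𝒜 a)) = algebraMap k _ (counit (R := k) a) := by
  have h : ∀ t : A ⊗[k] A,
      evenMk 𝒜 (liftedMul 𝒜 T ((evenMk 𝒜).toLinearMap.lTensor A t)) =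
      LinearMap.mul' k _ ((HopfAlgebra.antipode k).lTensor (EvenQuotient 𝒜)
        (TensorProduct.map (evenMk 𝒜).toLinearMap (evenMk 𝒜).toLinearMap t)) := by
    intro t
    induction t using TensorProduct.induction_on with
    | zero => simp only [map_zero]
    | add x y hx hy => simp only [map_add, hx, hy]
    | tmul x y =>
      simp only [LinearMap.lTensor_tmul, TensorProduct.map_tmul, liftedMul_tmul, map_mul, hT,
        LinearMap.mul'_apply, AlgHom.toLinearMap_apply]
      exact evenQuotient_mul_comm 𝒜 _ _
  rw [rightCoaction_apply, h, ← comul_evenMk, HopfAlgebra.mul_antipode_lTensor_comul_apply,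
    counit_evenMk]

theorem liftedMul_mul_mem {T : EvenQuotient 𝒜 →ₗ[k] A}
    (hT : ∀ y, evenMk 𝒜 (T y) = HopfAlgebra.antipode k y) {a : A}
    (ha : counit (R := k) a = 0) {j : ℕ} {w : A ⊗[k] EvenQuotient 𝒜}
    (hw : w ∈ Submodule.map₂ (TensorProduct.mk k A (EvenQuotient 𝒜)) (oddFiltration 𝒜 j) ⊤) :
    liftedMul 𝒜 T (rightCoaction 𝒜 a * w) ∈ oddFiltration 𝒜 (j + 1) := by
  have hT_mul : ∀ y z, T (z * y) - T y * T z ∈ oddIdeal 𝒜 := by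
    intro y z
    rw [← evenMk_eq_zero_iff, map_sub, hT, map_mul (evenMk 𝒜), hT, hT,
      HopfAlgebra.antipode_mul_antidistrib, sub_self]
  suffices h : Submodule.map₂ (TensorProduct.mk k A (EvenQuotient 𝒜)) (oddFiltration 𝒜 j) ⊤ ≤
      (oddFiltration 𝒜 (j + 1)).comap
        (liftedMul 𝒜 T ∘ₗ LinearMap.mulLeft k (rightCoaction 𝒜 a)) from h hw
  rw [Submodule.map₂_le]
  intro x hx y _
  -- modulo the next step of the filtration, `T` may be treated as anti-multiplicative
  have h : ∀ z : A ⊗[k] EvenQuotient 𝒜, liftedMul 𝒜 T (z * x ⊗ₜ y) -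
      T y * (liftedMul 𝒜 T z * x) ∈ oddFiltration 𝒜 (j + 1) := by
    intro z
    induction z using TensorProduct.induction_on with
    | zero => simp
    | add z z' hz hz' =>
      simp only [add_mul, map_add, mul_add]
      rw [add_sub_add_comm]
      exact add_mem hz hz'
    | tmul c d =>
      rw [Algebra.TensorProduct.tmul_mul_tmul, liftedMul_tmul, liftedMul_tmul]
      have h2 : T (d * y) * (c * x) - T y * (T d * c * x) =
          (T (d * y) - T y * T d) * (c * x) := by noncomm_ring
      rw [h2]
      exact mul_mem_oddFiltration_succ 𝒜 (hT_mul y d) (mul_mem_oddFiltration 𝒜 c hx)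
  have h3 : liftedMul 𝒜 T (rightCoaction 𝒜 a) ∈ oddIdeal 𝒜 := by
    rw [← evenMk_eq_zero_iff, evenMk_liftedMul_rightCoaction 𝒜 hT, ha, map_zero]
  have h4 := add_mem (h (rightCoaction 𝒜 a))
    (mul_mem_oddFiltration 𝒜 (T y) (mul_mem_oddFiltration_succ 𝒜 h3 hx))
  rwa [sub_add_cancel] at h4

/-- On the coinvariants, vanishing at the identity in the layer `j` of the filtration means lying
in the layer `j + 1`; this is the uniqueness part of the structure theorem for Hopf modules. -/
theorem rightCoinvariants_inf_le (j : ℕ) :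
    rightCoinvariants 𝒜 ⊓ LinearMap.ker (counit (R := k) (A := A)) * oddFiltration 𝒜 j ≤
      oddFiltration 𝒜 (j + 1) := by
  rintro b ⟨hb, hb'⟩
  obtain ⟨s, hs⟩ := (evenMk 𝒜).toLinearMap.exists_rightInverse_of_surjective
    (LinearMap.range_eq_top.mpr (Ideal.Quotient.mkₐ_surjective k (oddIdeal 𝒜)))
  let T : EvenQuotient 𝒜 →ₗ[k] A := s ∘ₗ HopfAlgebra.antipode k
  have hT : ∀ y, evenMk 𝒜 (T y) = HopfAlgebra.antipode k y := fun y => congr($hs _)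
  have h1 : LinearMap.ker (counit (R := k) (A := A)) * oddFiltration 𝒜 j ≤
      (oddFiltration 𝒜 (j + 1)).comap (liftedMul 𝒜 T ∘ₗ (rightCoaction 𝒜).toLinearMap) := by
    rw [Submodule.mul_le]
    intro a ha x hx
    have := liftedMul_mul_mem 𝒜 hT ha (rightCoaction_mem 𝒜 hx)
    rwa [← map_mul] at this
  have h2 : liftedMul 𝒜 T (rightCoaction 𝒜 b) ∈ oddFiltration 𝒜 (j + 1) := h1 hb'
  have h3 : rightCoaction 𝒜 b = b ⊗ₜ 1 := hb
  rw [h3, liftedMul_tmul] at h2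
  have h4 : b ∈ oddFiltration 𝒜 j := by
    rw [← top_mul_oddFiltration]
    have h : LinearMap.ker (counit (R := k) (A := A)) * oddFiltration 𝒜 j ≤
        ⊤ * oddFiltration 𝒜 j := mul_le_mul' le_top le_rfl
    exact h hb'
  have h5 : T 1 - 1 ∈ oddIdeal 𝒜 := by
    rw [← evenMk_eq_zero_iff, map_sub, hT, HopfAlgebra.antipode_one, map_one, sub_self]
  have h6 := sub_mem h2 (mul_mem_oddFiltration_succ 𝒜 h5 h4)
  rwa [sub_mul, one_mul, sub_sub_cancel] at h6

theorem rightCoinvariants_fg [Algebra.FiniteType k A] (hk : ringChar k ≠ 2) :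
    (rightCoinvariants 𝒜).FG := by
  obtain ⟨X, hfg, hX, hgen⟩ := exists_odd_generators 𝒜
  obtain ⟨N, hN⟩ := exists_oddFiltration_eq_bot 𝒜 hk
  -- descending induction on the layer
  have h : ∀ d j, j + d = N → (rightCoinvariants 𝒜 ⊓ oddFiltration 𝒜 j).FG := by
    intro d
    induction d with
    | zero =>
      rintro j rfl
      rw [← add_zero j, hN, inf_bot_eq]
      exact Submodule.fg_bot
    | succ d ih =>
      intro j hj
      let M := LinearMap.ker (counit (R := k) (A := A))
      refine Submodule.fg_of_fg_map_of_fg_inf_ker (M * oddFiltration 𝒜 j).mkQ ?_ ?_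
      · -- `A = k + M`, so a layer is spanned by `X ^ j` modulo its product with `M`
        have h1 : oddFiltration 𝒜 j ≤ X ^ j ⊔ M * oddFiltration 𝒜 j := by
          refine (oddFiltration_le 𝒜 hX hgen j).trans ?_
          rw [Submodule.mul_le]
          intro a _ x hx
          have h2 : a * x = counit (R := k) a • x +
              (a - algebraMap k A (counit (R := k) a)) * x := by
            rw [sub_mul, Algebra.smul_def, add_sub_cancel]
          rw [h2]
          refine Submodule.add_mem_sup (Submodule.smul_mem _ _ hx) (Submodule.mul_mem_mul ?_ ?_)
          · rw [LinearMap.mem_ker, Algebra.algebraMap_eq_smul_one, map_sub, map_smul,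
              SuperHopfAlgebra.counit_one 𝒜, smul_eq_mul, mul_one, sub_self]
          · have h3 := Submodule.mul_mem_mul (Submodule.mem_top (R := k) (x := (1 : A)))
              (pow_le_pow_left' hX j hx)
            rwa [one_mul] at h3
        refine Submodule.FG.of_le ((hfg.pow j).map (M * oddFiltration 𝒜 j).mkQ) ?_
        refine (Submodule.map_mono (inf_le_right.trans h1)).trans ?_
        rw [Submodule.map_sup, Submodule.mkQ_map_self, sup_bot_eq]
      · rw [Submodule.ker_mkQ]
        refine Submodule.FG.of_le (ih (j + 1) (by omega)) ?_
        rintro b ⟨⟨hb, _⟩, hb'⟩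
        exact ⟨hb, rightCoinvariants_inf_le 𝒜 j ⟨hb, hb'⟩⟩
  have h0 := h N 0 (zero_add N)
  rwa [oddFiltration_zero, inf_top_eq] at h0

/-- The pullback of an integral along `A → A / (A_1)` satisfies the criterion for `A`, since its
translates are coinvariants. -/
theorem hasIntegral_of_evenQuotient [Algebra.FiniteType k A] (hk : ringChar k ≠ 2)
    (h : HasIntegral k (EvenQuotient 𝒜)) : HasIntegral k A := by
  obtain ⟨φ, hφ0, hφ⟩ := hasIntegral_iff.mp h
  let f : A →ₗ[k] k := φ ∘ₗ (evenMk 𝒜).toLinearMap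
  have htr : ∀ a, evenMk 𝒜 (translate f a) = f a • (1 : EvenQuotient 𝒜) := by
    intro a
    have h1 : ∀ t : A ⊗[k] A, evenMk 𝒜 (contract f t) =
        contract φ (TensorProduct.map (evenMk 𝒜).toLinearMap (evenMk 𝒜).toLinearMap t) := by
      intro t
      induction t using TensorProduct.induction_on with
      | zero => simp only [map_zero]
      | add x y hx hy => simp only [map_add, hx, hy]
      | tmul x y => simp [f]
    exact (h1 (comul a)).trans (hφ (evenMk 𝒜 a))
  refine hasIntegral_of_finite_range 𝒜 (f := f) ?_ ?_
    (Submodule.FG.of_le (rightCoinvariants_fg 𝒜 hk) ?_)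
  · intro hf
    refine hφ0 (LinearMap.ext fun y => ?_)
    obtain ⟨a, rfl⟩ := Ideal.Quotient.mkₐ_surjective k (oddIdeal 𝒜) y
    exact LinearMap.congr_fun hf a
  · intro a ha
    rw [LinearMap.comp_apply, AlgHom.toLinearMap_apply, evenMk_odd ha, map_zero]
  · rintro _ ⟨a, rfl⟩
    change rightCoaction 𝒜 (translate f a) = translate f a ⊗ₜ 1
    have h2 : ∀ t : A ⊗[k] A,
        (evenMk 𝒜).toLinearMap.lTensor A ((translate f).lTensor A t) = contract f t ⊗ₜ 1 := by
      intro t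
      induction t using TensorProduct.induction_on with
      | zero => simp only [map_zero, TensorProduct.zero_tmul]
      | add x y hx hy => simp only [map_add, TensorProduct.add_tmul, hx, hy]
      | tmul x y =>
        rw [LinearMap.lTensor_tmul, LinearMap.lTensor_tmul, AlgHom.toLinearMap_apply, htr,
          contract_tmul, TensorProduct.tmul_smul, TensorProduct.smul_tmul']
    rw [rightCoaction_apply, comul_translate, h2]
    rfl

end Coinvariants

/-! ### Ordinary Hopf algebras as purely even super Hopf algebras -/

section TrivialGrading

variable (k : Type u) (B : Type v) [Field k] [Ring B]

/-- The grading for which every element is even. -/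
def trivialGrading [Algebra k B] (i : ZMod 2) : Submodule k B := if i = 0 then ⊤ else ⊥

theorem mem_trivialGrading_zero [Algebra k B] (b : B) : b ∈ trivialGrading k B 0 :=
  Submodule.mem_top

variable {k B} in
theorem eq_zero_of_mem_trivialGrading [Algebra k B] {i : ZMod 2} (hi : i ≠ 0) {b : B}
    (hb : b ∈ trivialGrading k B i) : b = 0 := by
  rw [trivialGrading, if_neg hi] at hb
  exact hb

/-- The decomposition map of the trivial grading: an element is its own component of degree `0`. -/
def trivialDecompose [Algebra k B] : B →ₗ[k] DirectSum (ZMod 2) fun i => trivialGrading k B i :=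
  DirectSum.lof k (ZMod 2) (fun i => trivialGrading k B i) 0 ∘ₗ
    LinearMap.id.codRestrict _ (mem_trivialGrading_zero k B)

instance [Algebra k B] : GradedAlgebra (trivialGrading k B) where
  one_mem := mem_trivialGrading_zero k B 1
  mul_mem i j a b ha hb := by
    by_cases hi : i = 0
    · by_cases hj : j = 0
      · subst hi hj
        exact mem_trivialGrading_zero k B _
      · rw [eq_zero_of_mem_trivialGrading hj hb, mul_zero]
        exact zero_mem _
    · rw [eq_zero_of_mem_trivialGrading hi ha, zero_mul]
      exact zero_mem _
  decompose' := trivialDecompose k B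
  left_inv b :=
    DirectSum.coeAddMonoidHom_of (trivialGrading k B) 0 ⟨b, mem_trivialGrading_zero k B b⟩
  right_inv x := by
    induction x using DirectSum.induction_on with
    | zero => rw [map_zero, map_zero]
    | add x y hx hy => rw [map_add, map_add, hx, hy]
    | of i b =>
      rw [DirectSum.coeAddMonoidHom_of]
      by_cases hi : i = 0
      · subst hi
        rfl
      · have hb : b = 0 := Subtype.ext (eq_zero_of_mem_trivialGrading hi b.2)
        rw [hb, map_zero, Submodule.coe_zero, map_zero]

theorem trivialGrading_of_mul_of [Algebra k B] (x y : B ⊗[k] B) :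
    GradedTensorProduct.of k (trivialGrading k B) (trivialGrading k B) x *
      GradedTensorProduct.of k (trivialGrading k B) (trivialGrading k B) y =
      GradedTensorProduct.of k (trivialGrading k B) (trivialGrading k B) (x * y) := by
  induction x using TensorProduct.induction_on with
  | zero => simp
  | add x x' hx hx' => simp only [add_mul, map_add, hx, hx']
  | tmul a b =>
    induction y using TensorProduct.induction_on with
    | zero => simp
    | add y y' hy hy' => simp only [mul_add, map_add, hy, hy']
    | tmul c d =>
      have h := GradedTensorProduct.tmul_coe_mul_coe_tmul (R := k) (trivialGrading k B)
        (trivialGrading k B) a ⟨b, mem_trivialGrading_zero k B b⟩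
        ⟨c, mem_trivialGrading_zero k B c⟩ d
      simp only [mul_zero, uzpow_zero, one_smul] at h
      rw [Algebra.TensorProduct.tmul_mul_tmul]
      exact h

instance [HopfAlgebra k B] : SuperHopfAlgebra k (trivialGrading k B) where
  comul_mem i b hb := by
    by_cases hi : i = 0
    · subst hi
      generalize comul (R := k) b = x
      induction x using TensorProduct.induction_on with
      | zero => exact zero_mem _
      | add x y hx hy => exact add_mem hx hy
      | tmul a c =>
        refine Submodule.mem_iSup_of_mem 0 (Submodule.mem_iSup_of_mem 0
          (Submodule.mem_iSup_of_mem (add_zero 0)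
            ⟨⟨a, mem_trivialGrading_zero k B a⟩ ⊗ₜ ⟨c, mem_trivialGrading_zero k B c⟩, ?_⟩))
        simp
    · rw [eq_zero_of_mem_trivialGrading hi hb, map_zero]
      exact zero_mem _
  comul_one := by rw [Bialgebra.comul_one]; rfl
  comul_mul a b := by rw [trivialGrading_of_mul_of, Bialgebra.comul_mul]
  counit_odd b hb := by rw [eq_zero_of_mem_trivialGrading one_ne_zero hb, map_zero]
  counit_one := Bialgebra.counit_one
  counit_mul := Bialgebra.counit_mul
  antipode := HopfAlgebra.antipode k
  antipode_mem i b hb := by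
    by_cases hi : i = 0
    · subst hi
      exact mem_trivialGrading_zero k B _
    · rw [eq_zero_of_mem_trivialGrading hi hb, map_zero]
      exact zero_mem _
  mul_antipode_rTensor_comul := HopfAlgebra.mul_antipode_rTensor_comul
  mul_antipode_lTensor_comul := HopfAlgebra.mul_antipode_lTensor_comul

variable {k B} in
theorem hasIntegral_of_finite_range_of_comm [HopfAlgebra k B] (hcomm : ∀ x y : B, x * y = y * x)
    {f : B →ₗ[k] k} (hf : f ≠ 0) (hfin : (LinearMap.range (translate f)).FG) :
    HasIntegral k B := by
  have : SuperCommutative (trivialGrading k B) :=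
    ⟨fun a _ b => hcomm a b, fun a ha b _ => by
      simp [eq_zero_of_mem_trivialGrading one_ne_zero ha]⟩
  refine hasIntegral_of_finite_range (trivialGrading k B) hf (fun a ha => ?_) hfin
  rw [eq_zero_of_mem_trivialGrading one_ne_zero ha, map_zero]

end TrivialGrading

/-! ### From `A` to `A / (A_1)`: integrals on the layers of the filtration -/

section Restrict

variable {k : Type u} {A : Type v} [Field k] [Ring A] [Algebra k A]
variable (𝒜 : ZMod 2 → Submodule k A) [GradedAlgebra 𝒜]
variable [Coalgebra k A] [SuperHopfAlgebra k 𝒜] [SuperCommutative 𝒜]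

/-- The left tensor factors of an element of `M ⊗ N` span a finite-dimensional space. -/
theorem exists_fg_contract_mem {M N : Type*} [AddCommGroup M] [Module k M] [AddCommGroup N]
    [Module k N] (t : M ⊗[k] N) :
    ∃ V : Submodule k M, V.FG ∧ ∀ g : N →ₗ[k] k, contract g t ∈ V := by
  induction t using TensorProduct.induction_on with
  | zero => exact ⟨⊥, Submodule.fg_bot, by simp⟩
  | add x y hx hy =>
    obtain ⟨V, hV, hV'⟩ := hx
    obtain ⟨W, hW, hW'⟩ := hy
    exact ⟨V ⊔ W, hV.sup hW, fun g => by
      rw [map_add]; exact Submodule.add_mem_sup (hV' g) (hW' g)⟩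
  | tmul a b =>
    refine ⟨k ∙ a, Submodule.fg_span_singleton a, fun g => ?_⟩
    rw [contract_tmul]
    exact Submodule.smul_mem _ _ (Submodule.mem_span_singleton_self a)

theorem contract_mul_tmul {B C : Type*} [Ring B] [Algebra k B] [Ring C] [Algebra k C]
    (φ : C →ₗ[k] k) (t : B ⊗[k] C) (z : B) (v : C) :
    contract φ (t * z ⊗ₜ v) = contract (φ ∘ₗ LinearMap.mulRight k v) t * z := by
  induction t using TensorProduct.induction_on with
  | zero => simp
  | add x y hx hy => simp only [add_mul, map_add, hx, hy]
  | tmul a b => simp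

theorem leftCoaction_coassoc (x : A) :
    (leftCoaction 𝒜).toLinearMap.lTensor _ (leftCoaction 𝒜 x) =
      TensorProduct.assoc k _ _ _ ((comul (R := k) (A := EvenQuotient 𝒜)).rTensor A
        (leftCoaction 𝒜 x)) := by
  let π := (evenMk 𝒜).toLinearMap
  have h1 : ∀ t : A ⊗[k] A, (leftCoaction 𝒜).toLinearMap.lTensor _ (π.rTensor A t) =
      TensorProduct.map π (π.rTensor A) (comul.lTensor A t) := by
    intro t
    induction t using TensorProduct.induction_on with
    | zero => simp only [map_zero]
    | add x y hx hy => simp only [map_add, hx, hy]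
    | tmul a b => rfl
  have h2 : ∀ t : A ⊗[k] A ⊗[k] A, TensorProduct.map π (π.rTensor A) (TensorProduct.assoc k _ _ _ t)
      = TensorProduct.assoc k _ _ _ ((TensorProduct.map π π).rTensor A t) := by
    intro t
    induction t using TensorProduct.induction_on with
    | zero => simp only [map_zero]
    | add x y hx hy => simp only [map_add, hx, hy]
    | tmul a b =>
      induction a using TensorProduct.induction_on with
      | zero => simp only [map_zero, TensorProduct.zero_tmul]
      | add x y hx hy => simp only [map_add, TensorProduct.add_tmul, hx, hy]
      | tmul a c => rfl
  have h3 : ∀ t : A ⊗[k] A, (TensorProduct.map π π).rTensor A (comul.rTensor A t) =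
      (comul (R := k) (A := EvenQuotient 𝒜)).rTensor A (π.rTensor A t) := by
    intro t
    induction t using TensorProduct.induction_on with
    | zero => simp only [map_zero]
    | add x y hx hy => simp only [map_add, hx, hy]
    | tmul a b => rfl
  rw [leftCoaction_apply, h1, ← coassoc_apply, h2, h3]

theorem counit_leftCoaction (x : A) :
    TensorProduct.lid k A ((counit (R := k) (A := EvenQuotient 𝒜)).rTensor A (leftCoaction 𝒜 x)) =
      x := by
  have h : (counit (R := k) (A := EvenQuotient 𝒜)).rTensor A
      ((evenMk 𝒜).toLinearMap.rTensor A (comul x)) = (counit (R := k)).rTensor A (comul x) := by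
    rw [← LinearMap.rTensor_comp_apply]
    rfl
  rw [leftCoaction_apply, h, rTensor_counit_comul]
  simp

variable {𝒜} in
/-- Let the integral `φ` vanish on the layer `j + 1`, let `x` be in the layer `j`, and let `s` be
a linear section of `π : A → A / (A_1)`. Then `w ↦ φ(s(w) x)` is a functional on `A / (A_1)` whose
translates are `∑ φ(s(w) x₂) S(π(x₁))`. -/
theorem translate_section {φ : A →ₗ[k] k} (hφ : ∀ a, translate φ a = φ a • (1 : A)) {j : ℕ}
    (hj : ∀ a ∈ oddFiltration 𝒜 (j + 1), φ a = 0) {s : EvenQuotient 𝒜 →ₗ[k] A}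
    (hs : ∀ y, evenMk 𝒜 (s y) = y) {x : A} (hx : x ∈ oddFiltration 𝒜 j) (w : EvenQuotient 𝒜) :
    translate (φ ∘ₗ LinearMap.mulRight k x ∘ₗ s) w =
      HopfAlgebra.antipode k (contract (φ ∘ₗ LinearMap.mulLeft k (s w)) (leftCoaction 𝒜 x)) := by
  let π := (evenMk 𝒜).toLinearMap
  let σ : EvenQuotient 𝒜 ⊗[k] A := s.lTensor _ (comul w)
  -- against the layer `j`, the functional `φ` only sees the left factor modulo `(A_1)`
  have h1 : ∀ t t' : EvenQuotient 𝒜 ⊗[k] A, π.lTensor _ t = π.lTensor _ t' →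
      ∀ y ∈ Submodule.map₂ (TensorProduct.mk k (EvenQuotient 𝒜) A) ⊤ (oddFiltration 𝒜 j),
        contract φ (t * y) = contract φ (t' * y) := by
    intro t t' htt y hy
    suffices h : Submodule.map₂ (TensorProduct.mk k (EvenQuotient 𝒜) A) ⊤ (oddFiltration 𝒜 j) ≤
        LinearMap.eqLocus (contract φ ∘ₗ LinearMap.mulLeft k t)
          (contract φ ∘ₗ LinearMap.mulLeft k t') from h hy
    rw [Submodule.map₂_le]
    intro z _ v hv
    have h2 : φ ∘ₗ LinearMap.mulRight k v = (φ ∘ₗ LinearMap.mulRight k v ∘ₗ s) ∘ₗ π := by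
      ext a
      have h3 : a - s (evenMk 𝒜 a) ∈ oddIdeal 𝒜 := by
        rw [← evenMk_eq_zero_iff, map_sub, hs, sub_self]
      have h4 := hj _ (mul_mem_oddFiltration_succ 𝒜 h3 hv)
      rw [sub_mul, map_sub, sub_eq_zero] at h4
      exact h4
    change contract φ (t * z ⊗ₜ v) = contract φ (t' * z ⊗ₜ v)
    rw [contract_mul_tmul, contract_mul_tmul, h2, ← contract_comp _ π, ← contract_comp _ π, htt]
  have hφ' : ∀ a, contract φ (leftCoaction 𝒜 a) = φ a • (1 : EvenQuotient 𝒜) := by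
    intro a
    have h : ∀ t : A ⊗[k] A, contract φ (π.rTensor A t) = π (contract φ t) := by
      intro t
      induction t using TensorProduct.induction_on with
      | zero => simp only [map_zero]
      | add x y hx hy => simp only [map_add, hx, hy]
      | tmul a b => simp only [LinearMap.rTensor_tmul, contract_tmul, map_smul]
    rw [leftCoaction_apply, h]
    change π (translate φ a) = _
    rw [hφ, map_smul]
    rfl
  -- left invariance of `φ` on the products `s(w) v`
  have h5 : ∀ v ∈ oddFiltration 𝒜 j,
      contract φ (σ * leftCoaction 𝒜 v) = φ (s w * v) • (1 : EvenQuotient 𝒜) := by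
    intro v hv
    rw [← hφ', map_mul (leftCoaction 𝒜)]
    refine h1 _ _ ?_ _ (leftCoaction_mem 𝒜 hv)
    have h6 : π.lTensor _ σ = comul w := by
      have h7 : π ∘ₗ s = LinearMap.id := LinearMap.ext hs
      rw [← LinearMap.lTensor_comp_apply, h7, LinearMap.lTensor_id]
      rfl
    have h8 : π.lTensor _ (leftCoaction 𝒜 (s w)) = comul (R := k) (evenMk 𝒜 (s w)) := by
      rw [comul_evenMk, leftCoaction_apply, ← LinearMap.comp_apply, LinearMap.lTensor_comp_rTensor]
    rw [h6, h8, hs]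
  -- apply `z ⊗ t ↦ S(z) * contract φ (σ * t)` to both sides of the coassociativity of the coaction
  let μ : EvenQuotient 𝒜 ⊗[k] A →ₗ[k] EvenQuotient 𝒜 := contract φ ∘ₗ LinearMap.mulLeft k σ
  have hμ : ∀ z v, μ (z ⊗ₜ v) = z * contract (φ ∘ₗ LinearMap.mulRight k v) σ := by
    intro z v
    rw [evenQuotient_mul_comm 𝒜]
    exact contract_mul_tmul φ σ z v
  let G := LinearMap.mul' k (EvenQuotient 𝒜) ∘ₗ TensorProduct.map (HopfAlgebra.antipode k) μ
  have hL : G ((leftCoaction 𝒜).toLinearMap.lTensor _ (leftCoaction 𝒜 x)) =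
      HopfAlgebra.antipode k
        (contract (φ ∘ₗ LinearMap.mulLeft k (s w)) (leftCoaction 𝒜 x)) := by
    suffices h : Submodule.map₂ (TensorProduct.mk k (EvenQuotient 𝒜) A) ⊤ (oddFiltration 𝒜 j) ≤
        LinearMap.eqLocus (G ∘ₗ (leftCoaction 𝒜).toLinearMap.lTensor _)
          (HopfAlgebra.antipode k ∘ₗ contract (φ ∘ₗ LinearMap.mulLeft k (s w))) from
      h (leftCoaction_mem 𝒜 hx)
    rw [Submodule.map₂_le]
    intro z _ v hv
    change HopfAlgebra.antipode k z * contract φ (σ * leftCoaction 𝒜 v) =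
      HopfAlgebra.antipode k (contract _ (z ⊗ₜ v))
    rw [h5 v hv, contract_tmul, map_smul, mul_smul_comm, mul_one]
    rfl
  have hR : ∀ t : EvenQuotient 𝒜 ⊗[k] A,
      G (TensorProduct.assoc k _ _ _ ((comul (R := k) (A := EvenQuotient 𝒜)).rTensor A t)) =
      contract φ (σ * 1 ⊗ₜ TensorProduct.lid k A
        ((counit (R := k) (A := EvenQuotient 𝒜)).rTensor A t)) := by
    intro t
    induction t using TensorProduct.induction_on with
    | zero => simp only [map_zero, TensorProduct.tmul_zero, mul_zero]
    | add x y hx hy => simp only [map_add, TensorProduct.tmul_add, mul_add, hx, hy]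
    | tmul z v =>
      have h9 : ∀ y : EvenQuotient 𝒜 ⊗[k] EvenQuotient 𝒜,
          G (TensorProduct.assoc k _ _ _ (y ⊗ₜ v)) =
          LinearMap.mul' k _ ((HopfAlgebra.antipode k).rTensor _ y) *
            contract (φ ∘ₗ LinearMap.mulRight k v) σ := by
        intro y
        induction y using TensorProduct.induction_on with
        | zero => simp only [map_zero, TensorProduct.zero_tmul, zero_mul]
        | add x y hx hy => simp only [map_add, TensorProduct.add_tmul, add_mul, hx, hy]
        | tmul c d =>
          rw [TensorProduct.assoc_tmul, LinearMap.rTensor_tmul, LinearMap.mul'_apply, mul_assoc,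
            ← hμ]
          rfl
      rw [LinearMap.rTensor_tmul, h9, HopfAlgebra.mul_antipode_rTensor_comul_apply,
        LinearMap.rTensor_tmul, TensorProduct.lid_tmul, TensorProduct.tmul_smul, mul_smul_comm,
        map_smul, contract_mul_tmul, mul_one, Algebra.smul_def]
  rw [← hL, leftCoaction_coassoc, hR, counit_leftCoaction, contract_mul_tmul, mul_one,
    contract_comp]
  rfl

/-- An integral on `A` gives, by multiplication with an element of the last layer on which it does
not vanish, a functional on `A / (A_1)` that satisfies the criterion. -/
theorem evenQuotient_hasIntegral [Algebra.FiniteType k A] (hk : ringChar k ≠ 2)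
    (h : HasIntegral k A) : HasIntegral k (EvenQuotient 𝒜) := by
  classical
  obtain ⟨φ, hφ0, hφ⟩ := hasIntegral_iff.mp h
  obtain ⟨N, hN⟩ := exists_oddFiltration_eq_bot 𝒜 hk
  have hex : ∃ j, ∀ a ∈ oddFiltration 𝒜 j, φ a = 0 := by
    refine ⟨N, fun a ha => ?_⟩
    rw [hN, Submodule.mem_bot] at ha
    rw [ha, map_zero]
  -- the last layer on which `φ` does not vanish
  obtain ⟨j, hj⟩ : ∃ j, Nat.find hex = j + 1 := by
    refine Nat.exists_eq_succ_of_ne_zero fun h0 => hφ0 ?_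
    have h1 := Nat.find_spec hex
    rw [h0, oddFiltration_zero] at h1
    exact LinearMap.ext fun a => h1 a Submodule.mem_top
  have hj1 : ∀ a ∈ oddFiltration 𝒜 (j + 1), φ a = 0 := hj ▸ Nat.find_spec hex
  have hj2 : ¬ ∀ a ∈ oddFiltration 𝒜 j, φ a = 0 := Nat.find_min hex (by omega)
  push Not at hj2
  obtain ⟨x, hx, hφx⟩ := hj2
  obtain ⟨s, hs⟩ := (evenMk 𝒜).toLinearMap.exists_rightInverse_of_surjective
    (LinearMap.range_eq_top.mpr (Ideal.Quotient.mkₐ_surjective k (oddIdeal 𝒜)))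
  have hs' : ∀ y, evenMk 𝒜 (s y) = y := fun y => congr($hs y)
  obtain ⟨V, hV, hV'⟩ := exists_fg_contract_mem (leftCoaction 𝒜 x)
  refine hasIntegral_of_finite_range_of_comm (evenQuotient_mul_comm 𝒜)
    (f := φ ∘ₗ LinearMap.mulRight k x ∘ₗ s) ?_
    (Submodule.FG.of_le (hV.map (HopfAlgebra.antipode k)) ?_)
  · intro h0
    have h1 : φ (s 1 * x) = 0 := congr($h0 1)
    have h2 : s 1 - 1 ∈ oddIdeal 𝒜 := by
      rw [← evenMk_eq_zero_iff, map_sub, hs', map_one, sub_self]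
    have h3 := hj1 _ (mul_mem_oddFiltration_succ 𝒜 h2 hx)
    rw [sub_mul, one_mul, map_sub, h1, zero_sub, neg_eq_zero] at h3
    exact hφx h3
  · rintro _ ⟨w, rfl⟩
    rw [translate_section hφ hj1 hs' hx]
    exact Submodule.mem_map_of_mem (hV' _)

end Restrict

end SuperGroup

end

theorem mainTheorem11 {k : Type*} {A : Type*} [Field k] (hk : ringChar k ≠ 2)
    [Ring A] [Algebra k A] (𝒜 : ZMod 2 → Submodule k A) [GradedAlgebra 𝒜]
    [Coalgebra k A] [SuperGroup.SuperHopfAlgebra k 𝒜] [SuperGroup.SuperCommutative 𝒜]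
    [Algebra.FiniteType k A] :
    SuperGroup.HasIntegral k A ↔ SuperGroup.HasIntegral k (SuperGroup.EvenQuotient 𝒜) :=
  ⟨SuperGroup.evenQuotient_hasIntegral 𝒜 hk, SuperGroup.hasIntegral_of_evenQuotient 𝒜 hk⟩
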